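/- Let $F$ be a $p$-adic field with ring of integers $\mathcal O_F$, uniformizer $\pi_F$ and residue field with $q$ elements, and normalize the absolute value of $F$ by $|\pi_F| = q^{-1}$. For a standard (block upper triangular) parabolic subgroup $P = MN$ of $GL_n$, with block diagonal Levi subgroup $M$ and unipotent radical $N$ with Lie algebra $\mathfrak n$, and for a locally constant compactly supported $f : GL_n(F) \to \mathbb C$, the constant term of $f$ is the function on $M(F)$ $$f^{(P)}(m) = |\det(m, \mathfrak n)|^{1/2} \int_{N(F)} f(m u)\, du ,$$ where $m$ acts on $\mathfrak n$ by conjugation and the Haar measure on $N(F)$ gives $N(F) \cap GL_n(\mathcal O_F)$ measure $1$. Let $T$ be the diagonal torus and $P_0$ the upper triangular Borel subgroup. Identify $\mathbb C[X_1^{\pm 1}, \dots, X_n^{\pm 1}]$ with the algebra of compactly supported $T(\mathcal O_F)$-invariant functions on $T(F)$, so that $X_k$ is the characteristic function of $a_k T(\mathcal O_F)$, where $a_k$ is diagonal with entry $\pi_F$ at $k$ and $1$ elsewhere. For $s \le n$ and $\alpha \ge 1$, let $f_{n\alpha s}$ be the locally constant, compactly supported, $GL_n(\mathcal O_F)$-bi-invariant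 function on $GL_n(F)$ whose Satake transform $f_{n\alpha s}^{(P_0)}$ is $$q^{\alpha s(n-s)/2} \sum_{I \subseteq \{1,\dots,n\},\ |I| = s} \Big(\prod_{i \in I} X_i\Big)^{\alpha} .$$ Let $C_c^{GL_n(F)}$ be the characteristic function of the set of those $g \in GL_n(F)$ all of whose eigenvalues in an algebraic closure of $F$ have the same absolute value. **Proposition 5.1.** Let $n, s, \alpha$ be positive integers with $s \le n$ and $\gcd(s, n) = 1$. Then for every proper standard parabolic subgroup $P = MN$ of $GL_n$, $$C_c^{GL_n(F)}(m)\, f_{n\alpha s}^{(P)}(m) = 0 \qquad \text{for all } m \in M(F) .$$ -/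

import Mathlib

open scoped Matrix

noncomputable section

namespace KottwitzFunction

/-! ### The field

`F` is a locally compact nonarchimedean nontrivially normed field; in the theorem it has
characteristic zero, so it is a `p`-adic field. -/

section Field

variable (F : Type*) [NontriviallyNormedField F] [IsUltrametricDist F]

/-- The ring of integers `𝒪_F = {x | ‖x‖ ≤ 1}`. -/
abbrev integers : ValuationSubring F := (NormedField.valuation (K := F)).valuationSubring

/-- `q`, the number of elements of the residue field of `F`. -/
def residueCard : ℕ := Nat.card (IsLocalRing.ResidueField (integers F))

end Field

section Haar

variable (F : Type*) [NontriviallyNormedField F] [ProperSpace F]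

/-- The closed unit ball, as a compact set with non-empty interior. -/
def unitBall : TopologicalSpace.PositiveCompacts F where
  carrier := Metric.closedBall 0 1
  isCompact' := isCompact_closedBall 0 1
  interior_nonempty' :=
    ⟨0, Metric.ball_subset_interior_closedBall (Metric.mem_ball_self one_pos)⟩

/-- The additive Haar measure on `F` for which `𝒪_F` has measure one. -/
def haarF [MeasurableSpace F] [BorelSpace F] : MeasureTheory.Measure F :=
  MeasureTheory.Measure.addHaarMeasure (unitBall F)

end Haar

/-! ### Standard parabolic subgroups of `GL_n`

A partition `(n_1, …, n_k)` of `n` in the sense of an ordered tuple of positive integers is a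
`Composition n`, and `c.index i` is the block that contains the index `i`. -/

section Parabolic

variable {n : ℕ} (c : Composition n) (F : Type*) [Field F]

/-- The standard parabolic subgroup `P(F)` of `GL_n(F)`: block upper triangular matrices. -/
def parabolic : Subgroup (GL (Fin n) F) where
  carrier := {g | Matrix.BlockTriangular (g : Matrix (Fin n) (Fin n) F) c.index}
  mul_mem' ha hb := by
    simpa using Matrix.BlockTriangular.mul ha hb
  one_mem' := by
    simpa using Matrix.blockTriangular_one
  inv_mem' {g} hg := by
    have := g.invertible
    simpa using Matrix.blockTriangular_inv_of_blockTriangular hg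

/-- The standard Levi subgroup `M(F) = GL_{n_1}(F) × ⋯ × GL_{n_k}(F)` of `P(F)`: block diagonal
matrices. -/
def levi : Subgroup (GL (Fin n) F) where
  carrier := {g | Matrix.BlockTriangular (g : Matrix (Fin n) (Fin n) F) c.index ∧
    Matrix.BlockTriangular (g : Matrix (Fin n) (Fin n) F) (OrderDual.toDual ∘ c.index)}
  mul_mem' ha hb := by
    simpa using And.intro (Matrix.BlockTriangular.mul ha.1 hb.1)
      (Matrix.BlockTriangular.mul ha.2 hb.2)
  one_mem' := by
    simpa using And.intro Matrix.blockTriangular_one Matrix.blockTriangular_one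
  inv_mem' {g} hg := by
    have := g.invertible
    simpa using And.intro (Matrix.blockTriangular_inv_of_blockTriangular hg.1)
      (Matrix.blockTriangular_inv_of_blockTriangular hg.2)

theorem mem_levi_iff {g : GL (Fin n) F} :
    g ∈ levi c F ↔ ∀ i j, c.index i ≠ c.index j → g i j = 0 := by
  constructor
  · rintro ⟨h1, h2⟩ i j hij
    rcases lt_or_gt_of_ne hij with h | h
    · exact h2 (OrderDual.toDual_lt_toDual.2 h)
    · exact h1 h
  · intro h
    exact ⟨fun i j hij => h i j (ne_of_gt hij),
      fun i j hij => h i j (ne_of_lt (OrderDual.toDual_lt_toDual.1 hij))⟩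

/-- The positions `(i, j)` strictly above the diagonal blocks. -/
abbrev NilIndex : Type := {ij : Fin n × Fin n // c.index ij.1 < c.index ij.2}

/-- The Lie algebra `𝔫` of the unipotent radical `N` of `P`: a family of entries at the positions
strictly above the diagonal blocks, viewed as a matrix. -/
def nilMatrix : (NilIndex c → F) →ₗ[F] Matrix (Fin n) (Fin n) F where
  toFun x := Matrix.of fun i j => if h : c.index i < c.index j then x ⟨(i, j), h⟩ else 0
  map_add' x y := by
    ext i j
    by_cases h : c.index i < c.index j <;> simp [h]
  map_smul' a x := by
    ext i j
    by_cases h : c.index i < c.index j <;> simp [h]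

variable {F} in
/-- The adjoint action `X ↦ m X m⁻¹` of `m` on `𝔫`, in the coordinates of `𝔫`. (If `m ∈ P(F)`
then `m X m⁻¹` lies in `𝔫` for every `X ∈ 𝔫`.) -/
def adjointAction (m : GL (Fin n) F) : (NilIndex c → F) →ₗ[F] (NilIndex c → F) where
  toFun x ij :=
    ((m : Matrix (Fin n) (Fin n) F) * nilMatrix c F x *
      ((m⁻¹ : GL (Fin n) F) : Matrix (Fin n) (Fin n) F)) ij.1.1 ij.1.2
  map_add' x y := by
    ext ij
    simp [mul_add, add_mul]
  map_smul' a x := by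
    ext ij
    simp

variable {c} in
theorem index_mono {i j : Fin n} (hij : i ≤ j) : c.index i ≤ c.index j := by
  by_contra h
  rw [not_le] at h
  have h1 := c.sizeUpTo_index_le i
  have h2 := c.lt_sizeUpTo_index_succ j
  have h3 : c.sizeUpTo (c.index j).succ ≤ c.sizeUpTo (c.index i) :=
    c.monotone_sizeUpTo (by rw [Fin.val_succ]; exact h)
  have h4 : (i : ℕ) ≤ j := hij
  omega

theorem det_one_add_nilMatrix (x : NilIndex c → F) :
    (1 + nilMatrix c F x).det = 1 := by
  have hle : ∀ i j : Fin n, j ≤ i → nilMatrix c F x i j = 0 := fun i j hij => by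
    have h := not_lt.2 (index_mono (c := c) hij)
    exact dif_neg h
  rw [Matrix.det_of_isUpperTriangular]
  · exact Finset.prod_eq_one fun i _ => by simp [hle i i le_rfl]
  · intro i j hij
    have hij' : j < i := hij
    simp [hle i j hij'.le, Matrix.one_apply_ne hij'.ne']

variable {F} in
/-- The element `1 + X` of the unipotent radical `N(F)` attached to `X ∈ 𝔫`. The map
`X ↦ 1 + X` is a bijection from `𝔫` onto `N(F)`. -/
def unipotent (x : NilIndex c → F) : GL (Fin n) F :=
  Matrix.GeneralLinearGroup.mkOfDetNeZero (1 + nilMatrix c F x)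
    (by rw [det_one_add_nilMatrix]; exact one_ne_zero)

end Parabolic

/-! ### The unramified Hecke algebra, constant terms, the Satake transform -/

section Hecke

variable {n : ℕ} {F : Type*} [NontriviallyNormedField F] [IsUltrametricDist F]

variable (n F) in
/-- The hyperspecial maximal compact subgroup `GL_n(𝒪_F)` of `GL_n(F)`. -/
def maximalCompact : Subgroup (GL (Fin n) F) :=
  (Matrix.GeneralLinearGroup.map (n := Fin n) (integers F).subtype).range

/-- `f` belongs to the unramified Hecke algebra of `GL_n(F)`: it is locally constant, compactly
supported and bi-invariant under `GL_n(𝒪_F)`. -/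
structure IsUnramified (f : GL (Fin n) F → ℂ) : Prop where
  isLocallyConstant : IsLocallyConstant f
  hasCompactSupport : HasCompactSupport f
  biinvariant : ∀ k₁ ∈ maximalCompact n F, ∀ k₂ ∈ maximalCompact n F, ∀ g,
    f (k₁ * g * k₂) = f g

/-- The modular character `δ_P(m) = |det(m, 𝔫)|`. -/
def modularCharacter (c : Composition n) (m : GL (Fin n) F) : ℝ :=
  ‖LinearMap.det (adjointAction c m)‖

/-- The constant term `f^{(P)}(m) = δ_P(m)^{1/2} ∫_{N(F)} f(m n) dn` for `m ∈ M(F)`. The Haar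
measure on `N(F)` is the product of the measures `haarF F` in the matrix coordinates of `N`, so
that `N(F) ∩ GL_n(𝒪_F)` has measure one. -/
def constantTerm [ProperSpace F] [MeasurableSpace F] [BorelSpace F] (c : Composition n)
    (f : GL (Fin n) F → ℂ) (m : levi c F) : ℂ :=
  ((modularCharacter c (m : GL (Fin n) F) ^ (1 / 2 : ℝ) : ℝ) : ℂ) *
    ∫ x : NilIndex c → F, f ((m : GL (Fin n) F) * unipotent c x)
      ∂(MeasureTheory.Measure.pi fun _ => haarF F)

variable (n F) in
/-- The diagonal torus `T(F)`: the standard Levi subgroup of the Borel subgroup of upper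
triangular matrices, which belongs to the partition `(1, …, 1)`. -/
abbrev torus : Subgroup (GL (Fin n) F) := levi (Composition.ones n) F

/-- The Satake transform `f ↦ f^{(P_0)}`, with `P_0` the Borel subgroup of upper triangular
matrices. -/
def satake [ProperSpace F] [MeasurableSpace F] [BorelSpace F] (f : GL (Fin n) F → ℂ) :
    torus n F → ℂ :=
  constantTerm (Composition.ones n) f

/-- The ring `ℂ[X_1^{±1}, …, X_n^{±1}]` of Laurent polynomials. -/
abbrev LaurentRing (n : ℕ) : Type := AddMonoidAlgebra ℂ (Fin n → ℤ)

/-- The variable `X_i`. -/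
def X (i : Fin n) : LaurentRing n := AddMonoidAlgebra.single (Pi.single i 1) 1

open Classical in
/-- The identification of `ℂ[X_1^{±1}, …, X_n^{±1}]` with the unramified Hecke algebra of `T(F)`
for which `X_k` is the characteristic function of `T(𝒪_F) a_k T(𝒪_F)`, where `a_k` is diagonal
with entry `ϖ` at `k` and `1` elsewhere. The monomial `X^l` goes to the characteristic function
of the coset of `T(𝒪_F)` that consists of the `t` with `‖t_i‖ = ‖ϖ‖ ^ l_i` for all `i`. -/
def toTorusFunction (ϖ : integers F) (Q : LaurentRing n) (t : torus n F) : ℂ :=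
  Q.coeff.sum fun l a =>
    if ∀ i, ‖(t : GL (Fin n) F) i i‖ = ‖(ϖ : F)‖ ^ (l i) then a else 0

/-- The polynomial `q^{α s (n - s) / 2} ∑_{I ⊆ {1, …, n}, |I| = s} (X^I)^α`, with
`X^I = ∏_{i ∈ I} X_i`. -/
def kottwitzPolynomial (q n α s : ℕ) : LaurentRing n :=
  (((q : ℝ) ^ ((α : ℝ) * s * ((n : ℝ) - s) / 2) : ℝ) : ℂ) •
    ∑ I ∈ Finset.powersetCard s (Finset.univ : Finset (Fin n)), (∏ i ∈ I, X i) ^ α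

/-- `f` is the function `f_{n α s}`: the element of the unramified Hecke algebra of `GL_n(F)`
whose Satake transform is `q^{α s (n - s) / 2} ∑_{|I| = s} (X^I)^α`. -/
structure IsKottwitzFunction [ProperSpace F] [MeasurableSpace F] [BorelSpace F]
    (ϖ : integers F) (α s : ℕ) (f : GL (Fin n) F → ℂ) : Prop where
  isUnramified : IsUnramified f
  satake_eq : satake f = toTorusFunction ϖ (kottwitzPolynomial (residueCard F) n α s)

end Hecke

/-! ### Compact elements -/

section Compact

variable {n : ℕ} {F : Type*} [NontriviallyNormedField F]

variable (n F) in
/-- The set of compact elements of `GL_n(F)`: all eigenvalues in an algebraic closure of `F` have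
the same norm, for the unique extension of the norm of `F`. -/
def compactElements : Set (GL (Fin n) F) :=
  {g | ∀ x ∈ (g : Matrix (Fin n) (Fin n) F).charpoly.aroots (AlgebraicClosure F),
    ∀ y ∈ (g : Matrix (Fin n) (Fin n) F).charpoly.aroots (AlgebraicClosure F),
      spectralNorm F (AlgebraicClosure F) x = spectralNorm F (AlgebraicClosure F) y}

variable (n F) in
/-- `C_c^{GL_n(F)}`, the characteristic function of the set of compact elements of `GL_n(F)`. -/
def compactIndicator : GL (Fin n) F → ℂ := (compactElements n F).indicator 1

end Compact

end KottwitzFunction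

end

noncomputable section

namespace KottwitzFunction

/-! ### Norms on a discretely valued field -/

section Field

variable {F : Type*} [NontriviallyNormedField F] [IsUltrametricDist F]

/-! Suppose both factors are nonzero at some `m ∈ M(F)`. Compactness gives all eigenvalues of `m`
one common norm `x`, so the diagonal block of size `n_b` has determinant of norm `x ^ n_b`
(`exists_norm_blockDet_eq`). Nonvanishing of the constant term at `m` is visible in the Satake
transform: it is nonzero at some `t ∈ T(F)` whose block determinants have the same norms
(`exists_torus_nilIntegral_ne_zero`). The shape of the polynomial then gives a set `I` of `s`
indices with `‖t_i‖ = ‖ϖ‖ ^ α` on `I` and `1` off it. With `s_b` the number of elements of `I` in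
the block, `x ^ n_b = ‖ϖ‖ ^ (α s_b)`, and multiplying over blocks `x ^ n = ‖ϖ‖ ^ (α s)`. Hence `s
n_b = s_b n`, and coprimality forces `n ∣ n_b` (`card_block_eq_of_compact`), impossible for a proper
parabolic.

The passage from `m` to `t` is the injectivity argument for the Satake transform of `M`, keeping
track of block determinants. The function `φ(g) = ∫_N f(g u) du` on `M(F)` is bi-invariant under
`M(𝒪_F)`, and up to a modular factor the Satake transform at `t` is the integral of `φ(t v)` over
the unipotent upper triangular `v ∈ M(F)` (`integral_unipotent_ones`). By the Cartan decomposition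
(`exists_cartan`) `φ` is nonzero at some dominant diagonal element; take `t` maximal among those
with the prescribed block determinant norms. If `φ(t v) ≠ 0` and `t v = k₁ t' k₂` with `t'`
dominant, comparing minors shows that `t'` dominates `t` (`prod_blockInitial_le`), so by maximality
they agree up to units and `φ(t v) = φ(t)`. The integrand takes only the values `0` and `φ(t)`, so
nothing cancels. -/

theorem mem_integers_iff {x : F} : x ∈ integers F ↔ ‖x‖ ≤ 1 := by
  rw [Valuation.mem_valuationSubring_iff]
  exact Iff.rfl

theorem isUnit_integers_iff {x : integers F} : IsUnit x ↔ ‖(x : F)‖ = 1 := by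
  constructor
  · intro h
    obtain ⟨y, hy⟩ := h.exists_right_inv
    have h1 : ‖(x : F)‖ * ‖(y : F)‖ = 1 := by
      rw [← norm_mul, ← norm_one (α := F)]
      exact congrArg norm (by exact_mod_cast congrArg Subtype.val hy)
    have hx := mem_integers_iff.1 x.2
    have hy := mem_integers_iff.1 y.2
    nlinarith [norm_nonneg (x : F), norm_nonneg (y : F)]
  · intro h
    have h0 : (x : F) ≠ 0 := fun h0 => by simp [h0] at h
    refine IsUnit.of_mul_eq_one ⟨(x : F)⁻¹, mem_integers_iff.2 (by simp [h])⟩ ?_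
    ext
    simp [h0]

variable {ϖ : integers F}

theorem norm_uniformizer_pos (hϖ : Irreducible ϖ) : 0 < ‖(ϖ : F)‖ := by
  rw [norm_pos_iff]
  exact fun h => hϖ.ne_zero (Subtype.ext h)

theorem norm_uniformizer_lt_one (hϖ : Irreducible ϖ) : ‖(ϖ : F)‖ < 1 :=
  lt_of_le_of_ne (mem_integers_iff.1 ϖ.2) fun h => hϖ.not_isUnit (isUnit_integers_iff.2 h)

/-- In the factorization `ϖ = x * (ϖ / x)` one factor must be a unit, and `ϖ / x` has norm less than
one. -/
theorem norm_eq_one_of_uniformizer_lt (hϖ : Irreducible ϖ) {x : F} (h1 : ‖(ϖ : F)‖ < ‖x‖) (h2 : ‖x‖ ≤ 1) :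
    ‖x‖ = 1 := by
  have hx : 0 < ‖x‖ := (norm_nonneg _).trans_lt h1
  have hx0 : x ≠ 0 := norm_pos_iff.1 hx
  have hq : ‖(ϖ : F) / x‖ < 1 := by rw [norm_div, div_lt_one hx]; exact h1
  have hfac : ϖ = (⟨x, mem_integers_iff.2 h2⟩ : integers F) *
      ⟨(ϖ : F) / x, mem_integers_iff.2 hq.le⟩ := by
    ext
    simp [mul_div_cancel₀, hx0]
  rcases hϖ.isUnit_or_isUnit hfac with h | h
  · exact isUnit_integers_iff.1 h
  · exact absurd (isUnit_integers_iff.1 h) hq.ne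

theorem exists_norm_eq_zpow (hϖ : Irreducible ϖ) {x : F} (hx : x ≠ 0) :
    ∃ z : ℤ, ‖x‖ = ‖(ϖ : F)‖ ^ z := by
  have h0 := norm_uniformizer_pos hϖ
  -- With base `‖ϖ‖⁻¹ > 1`, this `z` is the one for which `x * ϖ ^ (z + 1)` has norm in `(‖ϖ‖, 1]`,
  -- hence norm one.
  obtain ⟨z, hz1, hz2⟩ := exists_mem_Ioc_zpow (norm_pos_iff.2 hx)
    ((one_lt_inv₀ h0).2 (norm_uniformizer_lt_one hϖ))
  have hp : 0 < ‖(ϖ : F)‖ ^ (z + 1) := zpow_pos h0 _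
  refine ⟨-(z + 1), ?_⟩
  rw [inv_zpow] at hz1
  have hn : ‖x * (ϖ : F) ^ (z + 1)‖ = ‖x‖ * ‖(ϖ : F)‖ ^ (z + 1) := by
    rw [norm_mul, norm_zpow]
  have h := norm_eq_one_of_uniformizer_lt hϖ (x := x * (ϖ : F) ^ (z + 1)) (by
      rw [hn, zpow_add_one₀ h0.ne', ← mul_assoc]
      have := (inv_lt_iff_one_lt_mul₀ (zpow_pos h0 z)).1 hz1
      nlinarith) (by
      rw [hn]
      rw [inv_zpow] at hz2
      calc _ ≤ (‖(ϖ : F)‖ ^ (z + 1))⁻¹ * ‖(ϖ : F)‖ ^ (z + 1) :=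
            mul_le_mul_of_nonneg_right hz2 hp.le
        _ = 1 := inv_mul_cancel₀ hp.ne')
  rw [hn] at h
  rw [zpow_neg]
  exact eq_inv_of_mul_eq_one_left h

end Field

/-! ### Determinants over an ultrametric field -/

section Det

variable {F : Type*} [NontriviallyNormedField F] [IsUltrametricDist F]

theorem norm_det_le_one {ι : Type*} [Fintype ι] [DecidableEq ι] {A : Matrix ι ι F}
    (hA : ∀ i j, ‖A i j‖ ≤ 1) : ‖A.det‖ ≤ 1 := by
  rw [Matrix.det_apply]
  refine IsUltrametricDist.norm_sum_le_of_forall_le_of_nonneg zero_le_one fun σ _ => ?_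
  rw [Units.smul_def, ← Int.cast_smul_eq_zsmul F, smul_eq_mul, norm_mul, norm_prod]
  have h1 : ‖((Equiv.Perm.sign σ : ℤ) : F)‖ = 1 := by
    rcases Int.units_eq_one_or (Equiv.Perm.sign σ) with h | h <;> simp [h]
  rw [h1, one_mul]
  exact Finset.prod_le_one (fun _ _ => norm_nonneg _) fun _ _ => hA _ _

/-- Exchange argument: the image `S` of `φ` has as many elements as `R`, so `S \ R` and `R \ S` are
in bijection, and any bijection will do since each value on `S \ R` is at most every value on `R`.
-/
theorem prod_comp_le_prod_of_injective {ι : Type*} [DecidableEq ι] (R : Finset ι) (g : ι → ℝ)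
    (hg : ∀ i, 0 ≤ g i) (φ : R → ι) (hφ : Function.Injective φ)
    (h : ∀ a, φ a ∉ R → ∀ i ∈ R, g (φ a) ≤ g i) :
    ∏ a, g (φ a) ≤ ∏ i ∈ R, g i := by
  classical
  set S : Finset ι := Finset.univ.image φ with hS
  have hcard : S.card = R.card := by
    rw [hS, Finset.card_image_of_injective _ hφ, Finset.card_univ, Fintype.card_coe]
  have hcard' : (S \ R).card = (R \ S).card := by
    have h1 := Finset.card_sdiff_add_card_inter S R
    have h2 := Finset.card_sdiff_add_card_inter R S
    rw [Finset.inter_comm] at h2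
    omega
  have hprod : ∏ a, g (φ a) = ∏ i ∈ S, g i := by
    rw [hS, Finset.prod_image fun a _ b _ hab => hφ hab]
  let e := Finset.equivOfCardEq hcard'
  have hle : ∏ i ∈ S \ R, g i ≤ ∏ i ∈ R \ S, g i := by
    rw [← Finset.prod_coe_sort (S \ R), ← Finset.prod_coe_sort (R \ S),
      ← Equiv.prod_comp e fun i : ↥(R \ S) => g i]
    refine Finset.prod_le_prod (fun _ _ => hg _) fun i _ => ?_
    obtain ⟨hiS, hiR⟩ := Finset.mem_sdiff.1 i.2
    obtain ⟨a, -, ha⟩ := Finset.mem_image.1 hiS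
    rw [← ha] at hiR ⊢
    exact h a hiR _ (Finset.mem_sdiff.1 (e i).2).1
  rw [hprod, ← Finset.prod_inter_mul_prod_sdiff S R, ← Finset.prod_inter_mul_prod_sdiff R S,
    Finset.inter_comm R S]
  exact mul_le_mul_of_nonneg_left hle (Finset.prod_nonneg fun _ _ => hg _)

/-- If the entries of `d` at the indices of `R` dominate all others that matter, a minor on `R` of
a product `A * diagonal d * C` with integral `A` and `C` is at most `∏ i ∈ R, d i`. -/
theorem norm_det_mul_diagonal_mul_le {ι : Type*} [Fintype ι] [DecidableEq ι] (R : Finset ι)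
    (A : Matrix R ι F) (C : Matrix ι R F) (d : ι → F) (hA : ∀ a l, ‖A a l‖ ≤ 1)
    (hC : ∀ l a, ‖C l a‖ ≤ 1) (h : ∀ a l, A a l ≠ 0 → l ∉ R → ∀ i ∈ R, ‖d l‖ ≤ ‖d i‖) :
    ‖(A * Matrix.diagonal d * C).det‖ ≤ ∏ i ∈ R, ‖d i‖ := by
  -- Each row is a combination of rows of `C`, so multilinearity expands the determinant over all
  -- maps `φ : R → ι`, as in the Cauchy–Binet formula.
  have h1 : A * Matrix.diagonal d * C = fun a => ∑ l, (A a l * d l) • C l := by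
    ext a b
    rw [Matrix.mul_apply]
    simp [Matrix.mul_diagonal]
  have h2 : (A * Matrix.diagonal d * C).det =
      ∑ φ : R → ι, (∏ a, A a (φ a) * d (φ a)) • Matrix.det (fun a => C (φ a)) := by
    rw [h1]
    refine (MultilinearMap.map_sum Matrix.detRowAlternating.toMultilinearMap _).trans ?_
    exact Finset.sum_congr rfl fun φ _ => MultilinearMap.map_smul_univ _ _ _
  rw [h2]
  refine IsUltrametricDist.norm_sum_le_of_forall_le_of_nonneg
    (Finset.prod_nonneg fun _ _ => norm_nonneg _) fun φ _ => ?_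
  have hnn : 0 ≤ ∏ i ∈ R, ‖d i‖ := Finset.prod_nonneg fun _ _ => norm_nonneg _
  -- The hypothesis `h` controls `d` only at indices reached through nonzero entries of `A`, so the
  -- terms with a zero entry are removed first.
  by_cases hA0 : ∃ a, A a (φ a) = 0
  · obtain ⟨a, ha⟩ := hA0
    rw [Finset.prod_eq_zero (Finset.mem_univ a) (by rw [ha, zero_mul]), zero_smul, norm_zero]
    exact hnn
  push Not at hA0
  by_cases hφ : Function.Injective φ
  · rw [norm_smul, norm_prod]
    have hdet : ‖Matrix.det (fun a => C (φ a))‖ ≤ 1 := norm_det_le_one fun _ _ => hC _ _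
    calc _ ≤ ∏ a, ‖A a (φ a) * d (φ a)‖ :=
          mul_le_of_le_one_right (Finset.prod_nonneg fun _ _ => norm_nonneg _) hdet
      _ ≤ ∏ a, ‖d (φ a)‖ := Finset.prod_le_prod (fun _ _ => norm_nonneg _) fun a _ => by
          rw [norm_mul]
          exact mul_le_of_le_one_left (norm_nonneg _) (hA _ _)
      _ ≤ _ := prod_comp_le_prod_of_injective R (fun i => ‖d i‖) (fun _ => norm_nonneg _) φ hφ
          fun a ha => h a _ (hA0 a) ha
  · obtain ⟨a, b, hab, hne⟩ := Function.not_injective_iff.1 hφ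
    have h0 : Matrix.det (fun a => C (φ a)) = 0 :=
      Matrix.det_zero_of_row_eq hne (congrArg C hab)
    rw [h0, smul_zero, norm_zero]
    exact hnn

end Det

/-! ### The Cartan decomposition of the Levi subgroup -/

section Cartan

variable {n : ℕ} {F : Type*} [NontriviallyNormedField F] [IsUltrametricDist F]

theorem norm_apply_le_one_of_mem_maximalCompact {k : GL (Fin n) F} (hk : k ∈ maximalCompact n F)
    (i j : Fin n) : ‖k i j‖ ≤ 1 := by
  obtain ⟨g, rfl⟩ := hk
  exact mem_integers_iff.1 (g i j).2

theorem mem_maximalCompact_of_norm_le_one {k : GL (Fin n) F} (h : ∀ i j, ‖k i j‖ ≤ 1)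
    (h' : ∀ i j, ‖(k⁻¹ : GL (Fin n) F) i j‖ ≤ 1) : k ∈ maximalCompact n F := by
  let A : Matrix (Fin n) (Fin n) (integers F) :=
    Matrix.of fun i j => ⟨k i j, mem_integers_iff.2 (h i j)⟩
  let B : Matrix (Fin n) (Fin n) (integers F) :=
    Matrix.of fun i j => ⟨(k⁻¹ : GL (Fin n) F) i j, mem_integers_iff.2 (h' i j)⟩
  have hinj : Function.Injective ((integers F).subtype.mapMatrix (m := Fin n)) :=
    Matrix.map_injective Subtype.val_injective
  have hA : (integers F).subtype.mapMatrix A = k.val := rfl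
  have hB : (integers F).subtype.mapMatrix B = k⁻¹.val := rfl
  refine ⟨⟨A, B, hinj ?_, hinj ?_⟩, Units.ext hA⟩
  · rw [map_mul, hA, hB, map_one, Units.mul_inv]
  · rw [map_mul, hA, hB, map_one, Units.inv_mul]

/-- The maximal compact subgroup `M(𝒪_F)` of the standard Levi subgroup `M(F)`. -/
def compactLevi {n : ℕ} (c : Composition n) (F : Type*) [NontriviallyNormedField F]
    [IsUltrametricDist F] : Subgroup (GL (Fin n) F) :=
  maximalCompact n F ⊓ levi c F

variable {c : Composition n}

theorem compactLevi_le_maximalCompact : compactLevi c F ≤ maximalCompact n F := inf_le_left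

theorem compactLevi_le_levi : compactLevi c F ≤ levi c F := inf_le_right

theorem exists_compactLevi_eq {A B : Matrix (Fin n) (Fin n) F} (hAB : A * B = 1)
    (hA : ∀ i j, ‖A i j‖ ≤ 1) (hB : ∀ i j, ‖B i j‖ ≤ 1)
    (hc : ∀ i j, c.index i ≠ c.index j → A i j = 0) :
    ∃ k ∈ compactLevi c F, k.val = A :=
  ⟨⟨A, B, hAB, mul_eq_one_comm.1 hAB⟩,
    Subgroup.mem_inf.2 ⟨mem_maximalCompact_of_norm_le_one hA hB, (mem_levi_iff c F).2 hc⟩, rfl⟩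

variable (c) in
/-- Equivalence of matrices under left and right multiplication by `M(𝒪_F)`. -/
def LeviEquiv (A B : Matrix (Fin n) (Fin n) F) : Prop :=
  ∃ k₁ ∈ compactLevi c F, ∃ k₂ ∈ compactLevi c F, B = k₁.val * A * k₂.val

theorem LeviEquiv.trans {A B C : Matrix (Fin n) (Fin n) F} (h : LeviEquiv c A B)
    (h' : LeviEquiv c B C) : LeviEquiv c A C := by
  obtain ⟨k₁, hk₁, k₂, hk₂, rfl⟩ := h
  obtain ⟨l₁, hl₁, l₂, hl₂, rfl⟩ := h'
  refine ⟨l₁ * k₁, mul_mem hl₁ hk₁, k₂ * l₂, mul_mem hk₂ hl₂, ?_⟩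
  simp only [Units.val_mul, Matrix.mul_assoc]

theorem LeviEquiv.refl (A : Matrix (Fin n) (Fin n) F) : LeviEquiv c A A :=
  ⟨1, one_mem _, 1, one_mem _, by simp⟩

theorem leviEquiv_submatrix (A : Matrix (Fin n) (Fin n) F) {σ τ : Equiv.Perm (Fin n)}
    (hσ : ∀ i, c.index (σ i) = c.index i) (hτ : ∀ i, c.index (τ i) = c.index i) :
    LeviEquiv c A (A.submatrix σ τ) := by
  have key : ∀ ρ : Equiv.Perm (Fin n), (∀ i, c.index (ρ i) = c.index i) →
      ∃ k ∈ compactLevi c F, k.val = (1 : Matrix (Fin n) (Fin n) F).submatrix ρ id := by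
    intro ρ hρ
    have hle : ∀ i j : Fin n, ‖(1 : Matrix (Fin n) (Fin n) F) i j‖ ≤ 1 := by
      intro i j
      rw [Matrix.one_apply]
      split_ifs <;> simp
    refine exists_compactLevi_eq (B := (1 : Matrix (Fin n) (Fin n) F).submatrix id ρ) ?_
      (fun i j => hle _ _) (fun i j => hle _ _) fun i j hij => ?_
    · ext i j
      simp [Matrix.mul_apply, Matrix.one_apply]
    · refine Matrix.one_apply_ne fun h => hij ?_
      rw [← hρ i, h, id]
  obtain ⟨k₁, hk₁, h₁⟩ := key σ hσ
  obtain ⟨k₂, hk₂, h₂⟩ := key τ⁻¹ fun i => by simpa using (hτ (τ⁻¹ i)).symm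
  refine ⟨k₁, hk₁, k₂, hk₂, ?_⟩
  ext i j
  simp [h₁, h₂, Matrix.mul_apply, Matrix.one_apply, Equiv.symm_apply_eq]

/-- Left multiplication by `1 - v e_Jᵀ` followed by right multiplication by `1 - e_J wᵀ`: row
operations with row `J`, then column operations with column `J` as already modified. Since `v J = w
J = 0`, both rank-one matrices square to zero, so the inverses `1 + v e_Jᵀ` and `1 + e_J wᵀ` are
integral as well. -/
theorem leviEquiv_of_mul {A B : Matrix (Fin n) (Fin n) F} (J : Fin n) (v w : Fin n → F)
    (hv : ∀ i, ‖v i‖ ≤ 1) (hw : ∀ i, ‖w i‖ ≤ 1) (hvJ : v J = 0) (hwJ : w J = 0)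
    (hvc : ∀ i, c.index i ≠ c.index J → v i = 0) (hwc : ∀ i, c.index i ≠ c.index J → w i = 0)
    (hB : ∀ i j, B i j = A i j - v i * A J j - (A i J - v i * A J J) * w j) :
    LeviEquiv c A B := by
  have hle : ∀ u : Fin n → F, (∀ i, ‖u i‖ ≤ 1) → ∀ s : F, ‖s‖ ≤ 1 → ∀ i j,
      ‖((1 : Matrix (Fin n) (Fin n) F) + s • Matrix.vecMulVec u (Pi.single J 1)) i j‖ ≤ 1 := by
    intro u hu s hs i j
    refine (IsUltrametricDist.norm_add_le_max _ _).trans (max_le ?_ ?_)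
    · rw [Matrix.one_apply]
      split_ifs <;> simp
    · rw [Matrix.smul_apply, Matrix.vecMulVec_apply, smul_eq_mul, norm_mul, norm_mul]
      refine mul_le_one₀ hs (by positivity) (mul_le_one₀ (hu i) (norm_nonneg _) ?_)
      rw [Pi.single_apply]
      split_ifs <;> simp
  have hinv : ∀ u : Fin n → F, u J = 0 →
      ((1 : Matrix (Fin n) (Fin n) F) + (-1 : F) • Matrix.vecMulVec u (Pi.single J 1)) *
        (1 + (1 : F) • Matrix.vecMulVec u (Pi.single J 1)) = 1 := by
    intro u hu
    have h0 : Matrix.vecMulVec u (Pi.single J (1 : F)) * Matrix.vecMulVec u (Pi.single J 1) = 0 := by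
      rw [Matrix.vecMulVec_mul_vecMulVec]
      simp [hu]
    rw [neg_one_smul, one_smul, add_mul, mul_add, one_mul, neg_mul, mul_add, h0]
    simp
  obtain ⟨k₁, hk₁, h₁⟩ := exists_compactLevi_eq (c := c) (hinv v hvJ)
    (hle v hv _ (by simp)) (hle v hv _ (by simp)) (by
      intro i j hij
      have hne : i ≠ j := fun h => hij (by rw [h])
      by_cases hj : j = J
      · subst hj
        simp [Matrix.one_apply_ne hne, Matrix.vecMulVec_apply, hvc i hij]
      · simp [Matrix.one_apply_ne hne, Matrix.vecMulVec_apply, hj])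
  obtain ⟨k₂, hk₂, h₂⟩ := exists_compactLevi_eq (c := c)
    (A := ((1 : Matrix (Fin n) (Fin n) F) + (-1 : F) • Matrix.vecMulVec w (Pi.single J 1))ᵀ)
    (B := ((1 : Matrix (Fin n) (Fin n) F) + (1 : F) • Matrix.vecMulVec w (Pi.single J 1))ᵀ)
    (by rw [← Matrix.transpose_mul, mul_eq_one_comm.1 (hinv w hwJ), Matrix.transpose_one])
    (fun i j => hle w hw _ (by simp) j i) (fun i j => hle w hw _ (by simp) j i) (by
      intro i j hij
      have hne : j ≠ i := fun h => hij (by rw [h])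
      by_cases hj : i = J
      · subst hj
        simp [Matrix.one_apply_ne hne, Matrix.vecMulVec_apply, hwc j hij.symm]
      · simp [Matrix.one_apply_ne hne, Matrix.vecMulVec_apply, hj])
  refine ⟨k₁, hk₁, k₂, hk₂, ?_⟩
  have hrow : k₁.val * A = Matrix.of fun i j => A i j - v i * A J j := by
    ext i j
    rw [h₁, add_mul, one_mul, neg_one_smul, neg_mul, Matrix.vecMulVec_mul]
    simp [Matrix.vecMulVec_apply, sub_eq_add_neg]
  ext i j
  rw [hB, hrow, h₂, Matrix.transpose_add, Matrix.transpose_one, mul_add, mul_one,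
    Matrix.transpose_smul, Matrix.transpose_vecMulVec, neg_one_smul, mul_neg,
    Matrix.mul_vecMulVec]
  simp [Matrix.vecMulVec_apply, sub_eq_add_neg]

theorem LeviEquiv.apply_eq_zero {A B : Matrix (Fin n) (Fin n) F} (h : LeviEquiv c A B)
    (hA : ∀ i j, c.index i ≠ c.index j → A i j = 0) (i j : Fin n)
    (hij : c.index i ≠ c.index j) : B i j = 0 := by
  obtain ⟨k₁, hk₁, k₂, hk₂, rfl⟩ := h
  rw [Matrix.mul_apply]
  refine Finset.sum_eq_zero fun b _ => ?_
  by_cases hb : c.index b = c.index j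
  · rw [Matrix.mul_apply, Finset.sum_eq_zero, zero_mul]
    intro a _
    by_cases ha : c.index i = c.index a
    · rw [hA a b (by rw [← ha, hb]; exact hij), mul_zero]
    · rw [(mem_levi_iff c F).1 (compactLevi_le_levi hk₁) i a ha, zero_mul]
  · rw [(mem_levi_iff c F).1 (compactLevi_le_levi hk₂) b j hb, mul_zero]

theorem LeviEquiv.det_ne_zero {A B : Matrix (Fin n) (Fin n) F} (h : LeviEquiv c A B)
    (hA : A.det ≠ 0) : B.det ≠ 0 := by
  obtain ⟨k₁, -, k₂, -, rfl⟩ := h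
  rw [Matrix.det_mul, Matrix.det_mul]
  exact mul_ne_zero (mul_ne_zero k₁.det_ne_zero hA) k₂.det_ne_zero

variable (c) in
/-- The first `j` rows and columns of `A` are diagonal, with pivots of maximal norm in the remaining
rows of their block. -/
structure IsReducedUpTo (j : ℕ) (A : Matrix (Fin n) (Fin n) F) : Prop where
  apply_eq_zero : ∀ a b : Fin n, a ≠ b → ((a : ℕ) < j ∨ (b : ℕ) < j) → A a b = 0
  norm_le : ∀ a b d : Fin n, (a : ℕ) < j → a ≤ b → a ≤ d → c.index b = c.index a →
    ‖A b d‖ ≤ ‖A a a‖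

/-- An entry of largest norm in the unreduced part of the block of `J` is moved to `(J, J)` by a row
swap and a column swap inside the block; these fix all indices before `J`, so the reduced part is
undisturbed. -/
theorem exists_leviEquiv_pivot {A : Matrix (Fin n) (Fin n) F} (hdet : A.det ≠ 0)
    (hc : ∀ i j, c.index i ≠ c.index j → A i j = 0) (J : Fin n) (hA : IsReducedUpTo c J A) :
    ∃ B, LeviEquiv c A B ∧ IsReducedUpTo c J B ∧ B J J ≠ 0 ∧
      ∀ b d, J ≤ b → J ≤ d → c.index b = c.index J → ‖B b d‖ ≤ ‖B J J‖ := by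
  classical
  obtain ⟨⟨a₀, b₀⟩, hmem, hmax⟩ := Finset.exists_max_image
    (Finset.univ.filter fun p : Fin n × Fin n =>
      J ≤ p.1 ∧ J ≤ p.2 ∧ c.index p.1 = c.index J ∧ c.index p.2 = c.index J)
    (fun p => ‖A p.1 p.2‖) ⟨(J, J), by simp⟩
  simp only [Finset.mem_filter, Finset.mem_univ, true_and, Prod.forall] at hmem hmax
  obtain ⟨ha₀, hb₀, hac, hbc⟩ := hmem
  have hmax' : ∀ b d, J ≤ b → J ≤ d → c.index b = c.index J → ‖A b d‖ ≤ ‖A a₀ b₀‖ := by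
    intro b d hb hd hbJ
    by_cases hdJ : c.index d = c.index J
    · exact hmax b d ⟨hb, hd, hbJ, hdJ⟩
    · rw [hc b d (by rw [hbJ]; exact Ne.symm hdJ), norm_zero]
      exact norm_nonneg _
  -- Otherwise row `J` would vanish: before `J` because `A` is reduced, from `J` on by maximality.
  have hne : A a₀ b₀ ≠ 0 := by
    intro h0
    refine hdet (Matrix.det_eq_zero_of_row_eq_zero J fun b => ?_)
    rcases lt_or_ge b J with hb | hb
    · exact hA.apply_eq_zero J b hb.ne' (Or.inr hb)
    · have := hmax' J b le_rfl hb rfl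
      rwa [h0, norm_zero, norm_le_zero_iff] at this
  have hlt : ∀ x, J ≤ x → ∀ a < J, Equiv.swap J x a = a := fun x hx a ha =>
    Equiv.swap_apply_of_ne_of_ne ha.ne (ha.trans_le hx).ne
  have hge : ∀ x, J ≤ x → ∀ a, J ≤ a → J ≤ Equiv.swap J x a := by
    intro x hx a ha
    rw [Equiv.swap_apply_def]
    split_ifs
    exacts [hx, le_rfl, ha]
  have hidx : ∀ x, c.index x = c.index J → ∀ a, c.index (Equiv.swap J x a) = c.index a := by
    intro x hx a
    rw [Equiv.swap_apply_def]
    split_ifs with h1 h2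
    exacts [by rw [hx, h1], by rw [h2, hx], rfl]
  have hge' : ∀ x, J ≤ x → ∀ a b, a < J → a ≤ b → a ≤ Equiv.swap J x b := by
    intro x hx a b ha hab
    rcases lt_or_ge b J with hb | hb
    · rwa [hlt x hx b hb]
    · exact ha.le.trans (hge x hx b hb)
  refine ⟨A.submatrix (Equiv.swap J a₀) (Equiv.swap J b₀),
    leviEquiv_submatrix A (hidx a₀ hac) (hidx b₀ hbc), ⟨?_, ?_⟩, ?_, ?_⟩
  · intro a b hab hlt'
    refine hA.apply_eq_zero _ _ ?_ ?_
    · rcases lt_or_ge a J with ha | ha <;> rcases lt_or_ge b J with hb | hb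
      · rwa [hlt a₀ ha₀ a ha, hlt b₀ hb₀ b hb]
      · rw [hlt a₀ ha₀ a ha]
        exact (ha.trans_le (hge b₀ hb₀ b hb)).ne
      · rw [hlt b₀ hb₀ b hb]
        exact (hb.trans_le (hge a₀ ha₀ a ha)).ne'
      · rcases hlt' with h | h
        · exact absurd h (not_lt.2 ha)
        · exact absurd h (not_lt.2 hb)
    · rcases hlt' with h | h
      · exact Or.inl (by rwa [hlt a₀ ha₀ a h])
      · exact Or.inr (by rwa [hlt b₀ hb₀ b h])
  · intro a b d ha hab had hba
    have ha' : a < J := ha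
    simp only [Matrix.submatrix_apply]
    rw [hlt a₀ ha₀ a ha, hlt b₀ hb₀ a ha]
    exact hA.norm_le a _ _ ha (hge' a₀ ha₀ a b ha' hab) (hge' b₀ hb₀ a d ha' had)
      (by rw [hidx a₀ hac, hba])
  · simpa using hne
  · intro b d hb hd hbJ
    simp only [Matrix.submatrix_apply, Equiv.swap_apply_left]
    exact hmax' _ _ (hge a₀ ha₀ b hb) (hge b₀ hb₀ d hd) (by rw [hidx a₀ hac, hbJ])

/-- Gaussian elimination at the pivot. Its maximality makes the multipliers `A b J / A J J` and `A J
d / A J J` integral, and the ultrametric inequality keeps the new entries below the norms of all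
pivots so far. -/
theorem exists_leviEquiv_isReducedUpTo_succ {A : Matrix (Fin n) (Fin n) F}
    (hc : ∀ i j, c.index i ≠ c.index j → A i j = 0) (J : Fin n) (hA : IsReducedUpTo c J A)
    (hJ : A J J ≠ 0)
    (hmax : ∀ b d, J ≤ b → J ≤ d → c.index b = c.index J → ‖A b d‖ ≤ ‖A J J‖) :
    ∃ B, LeviEquiv c A B ∧ IsReducedUpTo c (J + 1) B := by
  have hJ' : 0 < ‖A J J‖ := norm_pos_iff.2 hJ
  have hcol : ∀ b, ‖A b J / A J J‖ ≤ 1 := by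
    intro b
    rw [norm_div, div_le_one hJ']
    by_cases hb : c.index b = c.index J
    · rcases lt_or_ge b J with h | h
      · simp [hA.apply_eq_zero b J h.ne (Or.inl h)]
      · exact hmax b J h le_rfl hb
    · simp [hc b J hb]
  have hrow : ∀ d, ‖A J d / A J J‖ ≤ 1 := by
    intro d
    rw [norm_div, div_le_one hJ']
    rcases lt_or_ge d J with h | h
    · simp [hA.apply_eq_zero J d h.ne' (Or.inr h)]
    · exact hmax J d le_rfl h rfl
  let B : Matrix (Fin n) (Fin n) F := Matrix.of fun a b =>
    if a = J ∨ b = J then (if a = b then A J J else 0) else A a b - A a J * (A J b / A J J)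
  have hBJ : B J J = A J J := by simp [B]
  have hBlt : ∀ a, a < J → B a a = A a a := by
    intro a ha
    simp [B, ha.ne, hA.apply_eq_zero a J ha.ne (Or.inl ha)]
  have hB0 : ∀ a b, (a = J ∨ b = J) → a ≠ b → B a b = 0 := by
    intro a b h hab
    simp [B, h, hab]
  have hB1 : ∀ a b, a ≠ J → b ≠ J → B a b = A a b - A a J * (A J b / A J J) := by
    intro a b ha hb
    simp [B, ha, hb]
  have hBle : ∀ b d x, ‖A b d‖ ≤ x → ‖A b J‖ ≤ x → b ≠ J → d ≠ J → ‖B b d‖ ≤ x := by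
    intro b d x h1 h2 hb hd
    rw [hB1 b d hb hd]
    rw [sub_eq_add_neg]
    refine (IsUltrametricDist.norm_add_le_max _ _).trans (max_le h1 ?_)
    rw [norm_neg, norm_mul]
    exact (mul_le_of_le_one_right (norm_nonneg _) (hrow d)).trans h2
  refine ⟨B, leviEquiv_of_mul J (fun a => if a = J then 0 else A a J / A J J)
    (fun b => if b = J then 0 else A J b / A J J) ?_ ?_ (by simp) (by simp) ?_ ?_ ?_, ⟨?_, ?_⟩⟩
  · intro i
    by_cases h : i = J
    · simp [h]
    · simpa only [h, if_false] using hcol i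
  · intro i
    by_cases h : i = J
    · simp [h]
    · simpa only [h, if_false] using hrow i
  · intro i hi
    simp [hc i J hi]
  · intro i hi
    simp [hc J i hi.symm]
  · intro a b
    by_cases ha : a = J <;> by_cases hb : b = J
    · subst ha; subst hb; simp [hBJ]
    · subst ha
      rw [hB0 a b (Or.inl rfl) (Ne.symm hb)]
      simp [hb]
      field_simp
      ring
    · subst hb
      rw [hB0 a b (Or.inr rfl) ha]
      simp [ha]
      field_simp
      ring
    · rw [hB1 a b ha hb]
      simp [ha, hb]
      field_simp
      ring
  · intro a b hab hlt
    by_cases h : a = J ∨ b = J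
    · exact hB0 a b h hab
    · push Not at h
      rw [hB1 a b h.1 h.2]
      have hlt' : (a : ℕ) < J ∨ (b : ℕ) < J := by
        have h1 := Fin.val_ne_of_ne h.1
        have h2 := Fin.val_ne_of_ne h.2
        omega
      rw [hA.apply_eq_zero a b hab hlt']
      rcases hlt' with h' | h'
      · rw [hA.apply_eq_zero a J h.1 (Or.inl h')]; simp
      · rw [hA.apply_eq_zero J b (Ne.symm h.2) (Or.inr h')]; simp
  · intro a b d ha hab had hba
    -- Any bound for the relevant entries of `A` passes to `B`; it is applied with the norm of the
    -- new pivot and with those of the earlier ones.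
    have hdiag : ∀ x, (∀ b d, a ≤ b → a ≤ d → c.index b = c.index a → ‖A b d‖ ≤ x) → a ≤ J →
        0 ≤ x → ‖B b d‖ ≤ x := by
      intro x hx haJ hx0
      by_cases h : b = J ∨ d = J
      · by_cases hbd : b = d
        · have hbJ : b = J := by rcases h with h | h <;> [exact h; exact hbd.trans h]
          rw [← hbd, hbJ, hBJ]
          exact hx J J haJ haJ (by rw [← hba, hbJ])
        · rw [hB0 b d h hbd, norm_zero]; exact hx0
      · push Not at h
        exact hBle b d x (hx b d hab had hba) (hx b J hab haJ hba) h.1 h.2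
    rcases eq_or_ne a J with h | h
    · subst h
      rw [hBJ]
      exact hdiag _ hmax le_rfl (norm_nonneg _)
    · have haJ : a < J := by
        have := Fin.val_ne_of_ne h
        exact Fin.lt_def.2 (by omega)
      rw [hBlt a haJ]
      exact hdiag _ (fun b d hb hd hbc => hA.norm_le a b d haJ hb hd hbc) haJ.le (norm_nonneg _)

/-- The Cartan decomposition of `M(F)`: up to `M(𝒪_F)` on both sides, an element of `M(F)` is
diagonal, with entries of decreasing norm in each block. -/
theorem exists_cartan {m : GL (Fin n) F} (hm : m ∈ levi c F) :
    ∃ t ∈ torus n F, (∃ k₁ ∈ compactLevi c F, ∃ k₂ ∈ compactLevi c F, m = k₁ * t * k₂) ∧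
      ∀ i j, i ≤ j → c.index i = c.index j → ‖t j j‖ ≤ ‖t i i‖ := by
  have key : ∀ j ≤ n, ∃ B, LeviEquiv c m.val B ∧ IsReducedUpTo c j B := by
    intro j
    induction j with
    | zero => exact fun _ => ⟨m.val, LeviEquiv.refl _, by simp, by simp⟩
    | succ j ih =>
      intro hj
      obtain ⟨A, hA, hAj⟩ := ih (by omega)
      have hAc := hA.apply_eq_zero ((mem_levi_iff c F).1 hm)
      obtain ⟨B, hB, hBj, hB0, hBmax⟩ := exists_leviEquiv_pivot
        (hA.det_ne_zero m.det_ne_zero) hAc ⟨j, hj⟩ hAj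
      obtain ⟨C, hC, hCj⟩ := exists_leviEquiv_isReducedUpTo_succ (hB.apply_eq_zero hAc) ⟨j, hj⟩
        hBj hB0 hBmax
      exact ⟨C, (hA.trans hB).trans hC, hCj⟩
  obtain ⟨B, ⟨k₁, hk₁, k₂, hk₂, hB⟩, hBn⟩ := key n le_rfl
  have hBt : B = (k₁ * m * k₂).val := by rw [hB]; rfl
  refine ⟨k₁ * m * k₂, ?_, ⟨k₁⁻¹, inv_mem hk₁, k₂⁻¹, inv_mem hk₂, by group⟩, ?_⟩
  · rw [mem_levi_iff]
    intro i j hij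
    rw [← hBt]
    exact hBn.apply_eq_zero i j (fun h => hij (by rw [h])) (Or.inl i.2)
  · intro i j hij hc
    rw [← hBt]
    exact hBn.norm_le i j j i.2 hij hij hc.symm

end Cartan

/-! ### Left and right multiplication by the Levi subgroup on `𝔫` -/

section Nil

variable {n : ℕ} {c : Composition n} {F : Type*} [Field F]

theorem nilMatrix_apply (x : NilIndex c → F) (ij : NilIndex c) :
    nilMatrix c F x ij.1.1 ij.1.2 = x ij := by
  obtain ⟨⟨i, j⟩, h⟩ := ij
  exact dif_pos h

theorem nilMatrix_apply_eq_zero (x : NilIndex c → F) {i j : Fin n}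
    (h : ¬ c.index i < c.index j) : nilMatrix c F x i j = 0 :=
  dif_neg h

theorem val_unipotent (x : NilIndex c → F) : (unipotent c x).val = 1 + nilMatrix c F x := rfl

theorem mul_nilMatrix_mul_apply_eq_zero {g₁ g₂ : GL (Fin n) F} (h₁ : g₁ ∈ levi c F)
    (h₂ : g₂ ∈ levi c F) (x : NilIndex c → F) {i j : Fin n} (h : ¬ c.index i < c.index j) :
    (g₁.val * nilMatrix c F x * g₂.val) i j = 0 := by
  rw [Matrix.mul_apply]
  refine Finset.sum_eq_zero fun b _ => ?_
  by_cases hb : c.index b = c.index j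
  · rw [Matrix.mul_apply, Finset.sum_eq_zero, zero_mul]
    intro a _
    by_cases ha : c.index i = c.index a
    · rw [nilMatrix_apply_eq_zero x (by rwa [← ha, hb]), mul_zero]
    · rw [(mem_levi_iff c F).1 h₁ i a ha, zero_mul]
  · rw [(mem_levi_iff c F).1 h₂ b j hb, mul_zero]

variable (c) in
/-- The coordinates of `g₁ X g₂` for `X ∈ 𝔫`. -/
def nilMul (g₁ g₂ : GL (Fin n) F) : (NilIndex c → F) →ₗ[F] (NilIndex c → F) where
  toFun x ij := (g₁.val * nilMatrix c F x * g₂.val) ij.1.1 ij.1.2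
  map_add' x y := by
    ext ij
    simp [mul_add, add_mul]
  map_smul' a x := by
    ext ij
    simp

theorem nilMatrix_nilMul {g₁ g₂ : GL (Fin n) F} (h₁ : g₁ ∈ levi c F) (h₂ : g₂ ∈ levi c F)
    (x : NilIndex c → F) :
    nilMatrix c F (nilMul c g₁ g₂ x) = g₁.val * nilMatrix c F x * g₂.val := by
  ext i j
  by_cases h : c.index i < c.index j
  · exact nilMatrix_apply (nilMul c g₁ g₂ x) ⟨(i, j), h⟩
  · rw [nilMatrix_apply_eq_zero _ h, mul_nilMatrix_mul_apply_eq_zero h₁ h₂ x h]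

theorem nilMul_nilMul {g₁ g₂ : GL (Fin n) F} (h₁ : g₁ ∈ levi c F) (h₂ : g₂ ∈ levi c F)
    (g₁' g₂' : GL (Fin n) F) (x : NilIndex c → F) :
    nilMul c g₁' g₂' (nilMul c g₁ g₂ x) = nilMul c (g₁' * g₁) (g₂ * g₂') x := by
  ext ij
  change (g₁'.val * nilMatrix c F (nilMul c g₁ g₂ x) * g₂'.val) _ _ =
    ((g₁' * g₁).val * nilMatrix c F x * (g₂ * g₂').val) _ _
  rw [nilMatrix_nilMul h₁ h₂]
  simp only [Units.val_mul, Matrix.mul_assoc]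

theorem nilMul_one (x : NilIndex c → F) : nilMul c 1 1 x = x := by
  ext ij
  change ((1 : GL (Fin n) F).val * nilMatrix c F x * (1 : GL (Fin n) F).val) _ _ = _
  rw [Units.val_one, one_mul, mul_one, nilMatrix_apply]

/-- The linear automorphism `X ↦ g₁ X g₂` of `𝔫`, for `g₁, g₂ ∈ M(F)`. -/
def nilEquiv {g₁ g₂ : GL (Fin n) F} (h₁ : g₁ ∈ levi c F) (h₂ : g₂ ∈ levi c F) :
    (NilIndex c → F) ≃ₗ[F] (NilIndex c → F) :=
  LinearEquiv.ofLinearMap (nilMul c g₁ g₂) (nilMul c g₁⁻¹ g₂⁻¹)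
    (LinearMap.ext fun x => by
      simp [nilMul_nilMul (inv_mem h₁) (inv_mem h₂), nilMul_one])
    (LinearMap.ext fun x => by
      simp [nilMul_nilMul h₁ h₂, nilMul_one])

theorem val_index_ones (i : Fin n) : ((Composition.ones n).index i : ℕ) = i := by
  have h1 := (Composition.ones n).sizeUpTo_index_le i
  have h2 := (Composition.ones n).lt_sizeUpTo_index_succ i
  rw [Composition.ones_sizeUpTo] at h1 h2
  have h3 := i.2
  simp only [Fin.val_succ] at h2
  omega

theorem index_ones_lt_iff {i j : Fin n} :
    (Composition.ones n).index i < (Composition.ones n).index j ↔ i < j := by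
  rw [Fin.lt_def, Fin.lt_def, val_index_ones, val_index_ones]

theorem mem_torus_iff {F : Type*} [NontriviallyNormedField F] {g : GL (Fin n) F} :
    g ∈ torus n F ↔ ∀ i j, i ≠ j → g i j = 0 := by
  rw [mem_levi_iff]
  refine forall₂_congr fun i j => ?_
  rw [Ne, Fin.ext_iff, val_index_ones, val_index_ones, ← Fin.ext_iff]

theorem torus_le_levi {F : Type*} [NontriviallyNormedField F] (c : Composition n) :
    torus n F ≤ levi c F := by
  intro g hg
  rw [mem_levi_iff]
  exact fun i j hij => mem_torus_iff.1 hg i j fun h => hij (by rw [h])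

variable (c) in
/-- The positions above the diagonal inside the diagonal blocks. -/
abbrev BlockIndex : Type := {ij : NilIndex (Composition.ones n) // ¬ c.index ij.1.1 < c.index ij.1.2}

/-- The positions above the diagonal blocks, as positions above the diagonal. -/
def nilIndexEquiv :
    {ij : NilIndex (Composition.ones n) // c.index ij.1.1 < c.index ij.1.2} ≃ NilIndex c where
  toFun ij := ⟨ij.1.1, ij.2⟩
  invFun ij := ⟨⟨ij.1, index_ones_lt_iff.2 (by
    by_contra h
    exact absurd ij.2 (not_lt.2 (index_mono (not_lt.1 h))))⟩, ij.2⟩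
  left_inv _ := rfl
  right_inv _ := rfl

/-- The entries of an upper triangular nilpotent matrix from those above the diagonal blocks and
those inside. -/
def joinEntries (z : NilIndex c → F) (y : BlockIndex c → F) : NilIndex (Composition.ones n) → F :=
  fun ij => if h : c.index ij.1.1 < c.index ij.1.2 then z ⟨ij.1, h⟩ else y ⟨ij, h⟩

theorem nilMatrix_joinEntries (z : NilIndex c → F) (y : BlockIndex c → F) :
    nilMatrix (Composition.ones n) F (joinEntries z y) =
      nilMatrix c F z + nilMatrix (Composition.ones n) F (joinEntries (0 : NilIndex c → F) y) := by
  ext i j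
  rw [Matrix.add_apply]
  by_cases h : i < j
  · have h' := index_ones_lt_iff.2 h
    have e1 := fun w => nilMatrix_apply (F := F) w (⟨(i, j), h'⟩ : NilIndex (Composition.ones n))
    simp only at e1
    rw [e1, e1]
    by_cases hc : c.index i < c.index j
    · have e2 := nilMatrix_apply z ⟨(i, j), hc⟩
      simp only at e2
      rw [e2]
      simp [joinEntries, hc]
    · rw [nilMatrix_apply_eq_zero z hc]
      simp [joinEntries, hc]
  · have h' := fun h' => h (index_ones_lt_iff.1 h')
    rw [nilMatrix_apply_eq_zero _ h', nilMatrix_apply_eq_zero _ h', nilMatrix_apply_eq_zero, add_zero]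
    exact not_lt.2 (index_mono (not_lt.1 h))

variable (c) in
/-- The unipotent upper triangular element of `M(F)` with the given entries. -/
def blockUnipotent (y : BlockIndex c → F) : GL (Fin n) F :=
  unipotent (Composition.ones n) (joinEntries (0 : NilIndex c → F) y)

theorem blockUnipotent_mem_levi (y : BlockIndex c → F) : blockUnipotent c y ∈ levi c F := by
  rw [mem_levi_iff]
  intro i j hij
  have hne : i ≠ j := fun h => hij (by rw [h])
  rw [blockUnipotent, val_unipotent, Matrix.add_apply, Matrix.one_apply_ne hne, zero_add]
  by_cases h : i < j
  · have hc : c.index i < c.index j := lt_of_le_of_ne (index_mono h.le) hij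
    have e := nilMatrix_apply (joinEntries (0 : NilIndex c → F) y)
      (⟨(i, j), index_ones_lt_iff.2 h⟩ : NilIndex (Composition.ones n))
    simp only at e
    rw [e]
    simp [joinEntries, hc]
  · exact nilMatrix_apply_eq_zero _ fun h' => h (index_ones_lt_iff.1 h')

/-- The identity `(1 + Y)(1 + Z) = 1 + Y + (1 + Y) Z`: the entries of the product above the blocks
are those of `(1 + Y) Z`, not of `Z`. This is the change of variables needed for integration in
stages. -/
theorem unipotent_joinEntries_nilMul (z : NilIndex c → F) (y : BlockIndex c → F) :
    unipotent (Composition.ones n) (joinEntries (nilMul c (blockUnipotent c y) 1 z) y) =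
      blockUnipotent c y * unipotent c z := by
  refine Units.ext ?_
  have h : (blockUnipotent c y).val =
      1 + nilMatrix (Composition.ones n) F (joinEntries (0 : NilIndex c → F) y) := rfl
  rw [Units.val_mul, val_unipotent, val_unipotent, nilMatrix_joinEntries,
    nilMatrix_nilMul (blockUnipotent_mem_levi y) (one_mem _), Units.val_one, mul_one, h]
  noncomm_ring

theorem unipotent_ones_apply (x : NilIndex (Composition.ones n) → F) {i j : Fin n} (h : j < i) :
    (unipotent (Composition.ones n) x).val i j = 0 := by
  rw [val_unipotent, Matrix.add_apply, Matrix.one_apply_ne h.ne', zero_add]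
  exact nilMatrix_apply_eq_zero _ fun h' => absurd (index_ones_lt_iff.1 h') h.not_gt

theorem unipotent_apply_self (x : NilIndex c → F) (i : Fin n) :
    (unipotent c x).val i i = 1 := by
  rw [val_unipotent, Matrix.add_apply, Matrix.one_apply_eq,
    nilMatrix_apply_eq_zero x (lt_irrefl _), add_zero]

theorem unipotent_ones_inv_apply (x : NilIndex (Composition.ones n) → F) {i j : Fin n}
    (h : j < i) : (unipotent (Composition.ones n) x)⁻¹.val i j = 0 := by
  have h1 : unipotent (Composition.ones n) x ∈ parabolic (Composition.ones n) F := by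
    intro i j hij
    exact unipotent_ones_apply x (index_ones_lt_iff.1 hij)
  exact inv_mem h1 (index_ones_lt_iff.2 h)

theorem unipotent_ones_inv_apply_self (x : NilIndex (Composition.ones n) → F) (i : Fin n) :
    (unipotent (Composition.ones n) x)⁻¹.val i i = 1 := by
  have h := congrFun (congrFun (unipotent (Composition.ones n) x).mul_inv i) i
  rw [Matrix.mul_apply, Finset.sum_eq_single i, unipotent_apply_self, one_mul,
    Matrix.one_apply_eq] at h
  · exact h
  · intro k _ hk
    rcases lt_or_gt_of_ne hk with h' | h'
    · rw [unipotent_ones_apply x h', zero_mul]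
    · rw [unipotent_ones_inv_apply x h', mul_zero]
  · simp

end Nil

/-! ### Haar measure on `𝔫` and integration in stages -/

section Integral

open MeasureTheory

variable {n : ℕ} {c : Composition n} {F : Type*} [NontriviallyNormedField F]

/-- The topology on units also requires continuity of the inverse, which is the adjugate because the
determinant is one. -/
theorem continuous_unipotent : Continuous (unipotent c : (NilIndex c → F) → GL (Fin n) F) := by
  have h : Continuous fun x : NilIndex c → F => (unipotent c x).val :=
    continuous_const.add (LinearMap.continuous_on_pi (nilMatrix c F))
  refine Units.continuous_iff.2 ⟨h, ?_⟩
  have h1 : ∀ x : NilIndex c → F, (unipotent c x)⁻¹.val = (unipotent c x).val.adjugate := by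
    intro x
    rw [Matrix.coe_units_inv, Matrix.inv_def, val_unipotent, det_one_add_nilMatrix,
      Ring.inverse_one, one_smul]
  simp_rw [h1]
  exact h.matrix_adjugate

/-- The coordinates `x` are read off continuously from `g = t * unipotent c x` as entries of `t⁻¹
g`, so the support lies in a continuous image of that of `f`. -/
theorem hasCompactSupport_comp_unipotent {f : GL (Fin n) F → ℂ} (hf : HasCompactSupport f)
    (t : GL (Fin n) F) : HasCompactSupport fun x : NilIndex c → F => f (t * unipotent c x) := by
  have hcont : Continuous fun (g : GL (Fin n) F) (ij : NilIndex c) =>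
      (t⁻¹ * g).val ij.1.1 ij.1.2 := by
    refine continuous_pi fun ij => ?_
    exact (Units.continuous_val.comp (continuous_const.mul continuous_id)).matrix_elem _ _
  refine HasCompactSupport.intro (hf.isCompact.image hcont) fun x hx => ?_
  by_contra h
  refine hx ⟨t * unipotent c x, subset_tsupport _ h, ?_⟩
  funext ij
  simp only [inv_mul_cancel_left, val_unipotent, Matrix.add_apply]
  rw [nilMatrix_apply, Matrix.one_apply_ne, zero_add]
  intro h'
  have := ij.2
  rw [h'] at this
  exact lt_irrefl _ this

/-- A linear automorphism of `F^ι` that preserves a box preserves the Haar measure. -/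
theorem measurePreserving_of_box [ProperSpace F] [MeasurableSpace F] [BorelSpace F]
    {ι : Type*} [Fintype ι] (μ : Measure (ι → F)) [μ.IsAddHaarMeasure]
    (L : (ι → F) ≃ₗ[F] (ι → F)) (r : ι → ℝ) (hr : ∀ i, 0 < r i)
    (h : ∀ x, (∀ i, ‖x i‖ ≤ r i) → ∀ i, ‖L x i‖ ≤ r i)
    (h' : ∀ x, (∀ i, ‖x i‖ ≤ r i) → ∀ i, ‖L.symm x i‖ ≤ r i) :
    MeasurePreserving L μ μ := by
  have hL : Continuous L := LinearMap.continuous_on_pi (L : (ι → F) →ₗ[F] (ι → F))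
  have hL' : Continuous L.symm := LinearMap.continuous_on_pi (L.symm : (ι → F) →ₗ[F] (ι → F))
  let K : TopologicalSpace.PositiveCompacts (ι → F) :=
    { carrier := Set.univ.pi fun i => Metric.closedBall 0 (r i)
      isCompact' := isCompact_univ_pi fun i => isCompact_closedBall _ _
      interior_nonempty' := by
        refine ⟨0, ?_⟩
        rw [interior_pi_set Set.finite_univ]
        exact fun i _ => Metric.ball_subset_interior_closedBall (Metric.mem_ball_self (hr i)) }
  have hmem : ∀ x, x ∈ (K : Set (ι → F)) ↔ ∀ i, ‖x i‖ ≤ r i := by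
    intro x
    change x ∈ Set.univ.pi (fun i => Metric.closedBall (0 : F) (r i)) ↔ _
    simp
  have hK : L ⁻¹' K = K := by
    ext x
    rw [Set.mem_preimage, hmem, hmem]
    exact ⟨fun hx => by simpa using h' _ hx, h x⟩
  refine ⟨hL.measurable, ?_⟩
  have : (μ.map L).IsAddHaarMeasure :=
    AddEquiv.isAddHaarMeasure_map μ L.toAddEquiv hL hL'
  -- Both measures are Haar measures giving `K` the same mass, as `L ⁻¹' K = K`.
  rw [Measure.addHaarMeasure_unique (μ.map L) K, Measure.map_apply hL.measurable
    K.isCompact.measurableSet, hK]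
  exact (Measure.addHaarMeasure_unique μ K).symm

instance [ProperSpace F] [MeasurableSpace F] [BorelSpace F] : (haarF F).IsAddHaarMeasure := by
  unfold haarF
  infer_instance

theorem norm_matrix_mul_le_one [IsUltrametricDist F] {A B : Matrix (Fin n) (Fin n) F} (hA : ∀ i j, ‖A i j‖ ≤ 1)
    (hB : ∀ i j, ‖B i j‖ ≤ 1) (i j : Fin n) : ‖(A * B) i j‖ ≤ 1 := by
  rw [Matrix.mul_apply]
  refine IsUltrametricDist.norm_sum_le_of_forall_le_of_nonneg zero_le_one fun k _ => ?_
  rw [norm_mul]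
  exact mul_le_one₀ (hA _ _) (norm_nonneg _) (hB _ _)

theorem norm_nilMatrix_le_one {x : NilIndex c → F} (hx : ∀ ij, ‖x ij‖ ≤ 1) (i j : Fin n) :
    ‖nilMatrix c F x i j‖ ≤ 1 := by
  by_cases h : c.index i < c.index j
  · exact (nilMatrix_apply x ⟨(i, j), h⟩ ▸ hx ⟨(i, j), h⟩ :)
  · rw [nilMatrix_apply_eq_zero x h, norm_zero]
    exact zero_le_one

variable [IsUltrametricDist F] [ProperSpace F] [MeasurableSpace F] [BorelSpace F]

theorem measurePreserving_nilMul_of_compactLevi {k₁ k₂ : GL (Fin n) F} (h₁ : k₁ ∈ compactLevi c F)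
    (h₂ : k₂ ∈ compactLevi c F) :
    MeasurePreserving (nilEquiv (compactLevi_le_levi h₁) (compactLevi_le_levi h₂)) (Measure.pi fun _ : NilIndex c => haarF F)
      (Measure.pi fun _ => haarF F) := by
  have key : ∀ {l₁ l₂ : GL (Fin n) F}, l₁ ∈ compactLevi c F → l₂ ∈ compactLevi c F →
      ∀ x : NilIndex c → F, (∀ i, ‖x i‖ ≤ 1) → ∀ i, ‖nilMul c l₁ l₂ x i‖ ≤ 1 := by
    intro l₁ l₂ hl₁ hl₂ x hx i
    exact norm_matrix_mul_le_one
      (norm_matrix_mul_le_one (norm_apply_le_one_of_mem_maximalCompact (compactLevi_le_maximalCompact hl₁))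
        (norm_nilMatrix_le_one hx)) (norm_apply_le_one_of_mem_maximalCompact (compactLevi_le_maximalCompact hl₂)) _ _
  exact measurePreserving_of_box _ _ (fun _ => 1) (fun _ => one_pos) (key h₁ h₂)
    (key (inv_mem h₁) (inv_mem h₂))

/-- The entries `y` need not be integral, so the unit box need not be preserved. Multiplication by
`g` adds to row `i` multiples of later rows with coefficients of norm at most `R`; a box of radius
`R ^ (n - i)` in row `i` absorbs this, and likewise for `g⁻¹`. -/
theorem measurePreserving_nilMul_blockUnipotent (y : BlockIndex c → F) :
    MeasurePreserving (nilEquiv (blockUnipotent_mem_levi y) (one_mem (levi c F)))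
      (Measure.pi fun _ : NilIndex c => haarF F) (Measure.pi fun _ => haarF F) := by
  set g := blockUnipotent c y with hg
  have hbdd : ∃ R : ℝ, 1 ≤ R ∧ (∀ i j, ‖g.val i j‖ ≤ R) ∧ ∀ i j, ‖g⁻¹.val i j‖ ≤ R := by
    refine ⟨1 + (∑ i, ∑ j, ‖g.val i j‖) + ∑ i, ∑ j, ‖g⁻¹.val i j‖, ?_, ?_, ?_⟩
    · have h1 : 0 ≤ ∑ i, ∑ j, ‖g.val i j‖ := by positivity
      have h2 : 0 ≤ ∑ i, ∑ j, ‖g⁻¹.val i j‖ := by positivity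
      linarith
    all_goals
      intro i j
      have h1 : 0 ≤ ∑ i, ∑ j, ‖g.val i j‖ := by positivity
      have h2 : 0 ≤ ∑ i, ∑ j, ‖g⁻¹.val i j‖ := by positivity
      have h3 : ∀ A : Matrix (Fin n) (Fin n) F, ‖A i j‖ ≤ ∑ i, ∑ j, ‖A i j‖ := fun A =>
        (Finset.single_le_sum (f := fun j => ‖A i j‖) (fun _ _ => norm_nonneg _)
          (Finset.mem_univ j)).trans
        (Finset.single_le_sum (f := fun i => ∑ j, ‖A i j‖)
          (fun _ _ => Finset.sum_nonneg fun _ _ => norm_nonneg _) (Finset.mem_univ i))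
      linarith [h3 g.val, h3 g⁻¹.val]
  obtain ⟨R, hR1, hgR, hgR'⟩ := hbdd
  have hR0 : 0 < R := one_pos.trans_le hR1
  have key : ∀ l : GL (Fin n) F, (∀ i j, ‖l.val i j‖ ≤ R) → (∀ i j, j < i → l.val i j = 0) →
      (∀ i, l.val i i = 1) → ∀ x : NilIndex c → F,
      (∀ i, ‖x i‖ ≤ R ^ (n - (i.1.1 : ℕ))) → ∀ i, ‖nilMul c l 1 x i‖ ≤ R ^ (n - (i.1.1 : ℕ)) := by
    intro l hl hlt hdiag x hx ij
    obtain ⟨⟨i, j⟩, hij⟩ := ij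
    change ‖(l.val * nilMatrix c F x * (1 : GL (Fin n) F).val) i j‖ ≤ R ^ (n - (i : ℕ))
    have hX : ∀ k, ‖nilMatrix c F x k j‖ ≤ R ^ (n - (k : ℕ)) := by
      intro k
      by_cases h : c.index k < c.index j
      · exact (nilMatrix_apply x ⟨(k, j), h⟩ ▸ hx ⟨(k, j), h⟩ :)
      · rw [nilMatrix_apply_eq_zero x h, norm_zero]
        positivity
    rw [Units.val_one, mul_one, Matrix.mul_apply]
    refine IsUltrametricDist.norm_sum_le_of_forall_le_of_nonneg (by positivity) fun k _ => ?_
    rw [norm_mul]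
    rcases lt_trichotomy k i with h | h | h
    · rw [hlt i k h, norm_zero, zero_mul]
      positivity
    · rw [h, hdiag, norm_one, one_mul]
      exact hX i
    · calc ‖l.val i k‖ * ‖nilMatrix c F x k j‖ ≤ R * R ^ (n - (k : ℕ)) :=
            mul_le_mul (hl i k) (hX k) (norm_nonneg _) hR0.le
        _ = R ^ (n - (k : ℕ) + 1) := (pow_succ' _ _).symm
        _ ≤ R ^ (n - (i : ℕ)) := pow_le_pow_right₀ hR1 (by
            have : (i : ℕ) < k := h
            omega)
  refine measurePreserving_of_box _ _ (fun i => R ^ (n - (i.1.1 : ℕ))) (fun _ => by positivity)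
    (key g hgR (fun i j => unipotent_ones_apply _) (unipotent_apply_self _)) fun x hx i => ?_
  have := key g⁻¹ hgR' (fun i j => unipotent_ones_inv_apply _)
    (unipotent_ones_inv_apply_self _) x hx i
  rw [← inv_one (G := GL (Fin n) F)] at this
  exact this

/-- The integral `∫_{N(F)} f(g u) du`. -/
def nilIntegral (c : Composition n) (f : GL (Fin n) F → ℂ) (g : GL (Fin n) F) : ℂ :=
  ∫ x : NilIndex c → F, f (g * unipotent c x) ∂(Measure.pi fun _ => haarF F)

theorem nilIntegral_mul_left {f : GL (Fin n) F → ℂ} (hf : IsUnramified f) {k : GL (Fin n) F}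
    (hk : k ∈ maximalCompact n F) (g : GL (Fin n) F) :
    nilIntegral c f (k * g) = nilIntegral c f g := by
  refine integral_congr_ae (Filter.Eventually.of_forall fun x => ?_)
  simpa [mul_assoc] using hf.biinvariant k hk 1 (one_mem _) (g * unipotent c x)

/-- Write `g k u = g (k u k⁻¹) k`: the final `k` is absorbed by `f`, and conjugation by `k`
preserves the measure on `N`. -/
theorem nilIntegral_mul_right {f : GL (Fin n) F → ℂ} (hf : IsUnramified f) {k : GL (Fin n) F}
    (hk : k ∈ compactLevi c F) (g : GL (Fin n) F) :
    nilIntegral c f (g * k) = nilIntegral c f g := by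
  have hmp := measurePreserving_nilMul_of_compactLevi hk (inv_mem hk)
  have hemb : MeasurableEmbedding (nilEquiv (compactLevi_le_levi hk) (compactLevi_le_levi (inv_mem hk))) :=
    (LinearEquiv.toContinuousLinearEquiv (nilEquiv (compactLevi_le_levi hk) (compactLevi_le_levi (inv_mem hk)))).toHomeomorph.measurableEmbedding
  refine Eq.trans ?_ (hmp.integral_comp hemb fun x => f (g * unipotent c x))
  refine integral_congr_ae (Filter.Eventually.of_forall fun x => ?_)
  have h : unipotent c (nilEquiv (compactLevi_le_levi hk) (compactLevi_le_levi (inv_mem hk)) x) = k * unipotent c x * k⁻¹ := by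
    refine Units.ext ?_
    change 1 + nilMatrix c F (nilMul c k k⁻¹ x) = k.val * (1 + nilMatrix c F x) * k⁻¹.val
    rw [nilMatrix_nilMul (compactLevi_le_levi hk) (inv_mem (compactLevi_le_levi hk)), mul_add, mul_one, add_mul, Units.mul_inv]
  have h2 := hf.biinvariant 1 (one_mem _) k (compactLevi_le_maximalCompact hk)
    (g * (k * unipotent c x * k⁻¹))
  simp only
  rw [h, ← h2]
  congr 1
  group

/-- The measurable equivalence between pairs of families of entries above and inside the diagonal
blocks and families of entries above the diagonal. -/
def joinMeasurableEquiv (c : Composition n) (F : Type*) [MeasurableSpace F] :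
    (NilIndex c → F) × (BlockIndex c → F) ≃ᵐ (NilIndex (Composition.ones n) → F) :=
  (MeasurableEquiv.prodCongr (MeasurableEquiv.piCongrLeft (fun _ => F) nilIndexEquiv).symm
    (MeasurableEquiv.refl _)).trans (MeasurableEquiv.piEquivPiSubtypeProd (fun _ => F)
      fun ij : NilIndex (Composition.ones n) => c.index ij.1.1 < c.index ij.1.2).symm

theorem measurePreserving_joinMeasurableEquiv :
    MeasurePreserving (joinMeasurableEquiv c F)
      ((Measure.pi fun _ : NilIndex c => haarF F).prod (Measure.pi fun _ => haarF F))
      (Measure.pi fun _ => haarF F) := by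
  refine MeasurePreserving.trans (μb := (Measure.pi fun _ => haarF F).prod
    (Measure.pi fun _ => haarF F)) ?_ ?_
  · exact ((measurePreserving_piCongrLeft (fun _ => haarF F) nilIndexEquiv).symm).prod
      (MeasurePreserving.id _)
  · exact (measurePreserving_piEquivPiSubtypeProd (fun _ => haarF F) _).symm

/-- Transitivity of constant terms, without modular factors: Fubini for the product of the unipotent
upper triangular subgroup of `M` with `N`, where for each fixed `y` the inner substitution `Z ↦ (1 +
Y) Z` preserves the measure. -/
theorem integral_unipotent_ones {f : GL (Fin n) F → ℂ} (hf : Continuous f)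
    (hf' : HasCompactSupport f) (t : GL (Fin n) F) :
    Integrable (fun y : BlockIndex c → F => nilIntegral c f (t * blockUnipotent c y))
        (Measure.pi fun _ => haarF F) ∧
      nilIntegral (Composition.ones n) f t =
        ∫ y : BlockIndex c → F, nilIntegral c f (t * blockUnipotent c y)
          ∂(Measure.pi fun _ => haarF F) := by
  have hintegrable : Integrable
      (fun x : NilIndex (Composition.ones n) → F => f (t * unipotent (Composition.ones n) x))
      (Measure.pi fun _ => haarF F) :=
    (hf.comp (continuous_const.mul continuous_unipotent)).integrable_of_hasCompactSupport
      (hasCompactSupport_comp_unipotent hf' t)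
  have hmp := measurePreserving_joinMeasurableEquiv (c := c) (F := F)
  have hintegrable' := (hmp.integrable_comp_emb (joinMeasurableEquiv c F).measurableEmbedding).2 hintegrable
  have hfib : ∀ y : BlockIndex c → F,
      ∫ z : NilIndex c → F, f (t * unipotent (Composition.ones n) (joinMeasurableEquiv c F (z, y)))
        ∂(Measure.pi fun _ => haarF F) = nilIntegral c f (t * blockUnipotent c y) := by
    intro y
    have hmp' := measurePreserving_nilMul_blockUnipotent y
    have hemb : MeasurableEmbedding
        (nilEquiv (blockUnipotent_mem_levi y) (one_mem (levi c F))) :=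
      (LinearEquiv.toContinuousLinearEquiv
        (nilEquiv (blockUnipotent_mem_levi y) (one_mem (levi c F)))).toHomeomorph.measurableEmbedding
    rw [← hmp'.integral_comp hemb]
    refine integral_congr_ae (Filter.Eventually.of_forall fun z => ?_)
    have h := unipotent_joinEntries_nilMul z y
    change f (t * unipotent (Composition.ones n)
      (joinEntries (nilMul c (blockUnipotent c y) 1 z) y)) = _
    rw [h, ← mul_assoc]
  constructor
  · refine hintegrable'.integral_prod_right.congr (Filter.Eventually.of_forall fun y => ?_)
    exact hfib y
  · rw [nilIntegral, ← hmp.integral_comp (joinMeasurableEquiv c F).measurableEmbedding]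
    exact (integral_prod_symm _ hintegrable').trans
      (integral_congr_ae (Filter.Eventually.of_forall hfib))

end Integral

/-! ### Block determinants and minors -/

section BlockDet

variable {n : ℕ} {c : Composition n} {F : Type*} [NontriviallyNormedField F]

theorem torus_mul_apply {t : GL (Fin n) F} (ht : t ∈ torus n F) (g : GL (Fin n) F)
    (i j : Fin n) : (t * g).val i j = t.val i i * g.val i j := by
  rw [Units.val_mul, Matrix.mul_apply, Finset.sum_eq_single i]
  · intro k _ hk
    rw [mem_torus_iff.1 ht i k hk.symm, zero_mul]
  · simp

theorem torus_apply_ne_zero {t : GL (Fin n) F} (ht : t ∈ torus n F) (i : Fin n) :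
    t.val i i ≠ 0 := by
  intro h
  have := torus_mul_apply ht t⁻¹ i i
  rw [mul_inv_cancel, h, zero_mul, Units.val_one, Matrix.one_apply_eq] at this
  exact one_ne_zero this

theorem torus_inv_apply {t : GL (Fin n) F} (ht : t ∈ torus n F) (i : Fin n) :
    t⁻¹.val i i = (t.val i i)⁻¹ := by
  have := torus_mul_apply ht t⁻¹ i i
  rw [mul_inv_cancel, Units.val_one, Matrix.one_apply_eq] at this
  exact eq_inv_of_mul_eq_one_right this.symm

theorem val_eq_diagonal {t : GL (Fin n) F} (ht : t ∈ torus n F) :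
    t.val = Matrix.diagonal fun i => t.val i i := by
  ext i j
  by_cases h : i = j
  · subst h
    rw [Matrix.diagonal_apply_eq]
  · rw [Matrix.diagonal_apply_ne _ h, mem_torus_iff.1 ht i j h]

theorem mem_compactLevi_of_torus [IsUltrametricDist F] {t : GL (Fin n) F} (ht : t ∈ torus n F)
    (h : ∀ i, ‖t.val i i‖ = 1) : t ∈ compactLevi c F := by
  have key : ∀ u : GL (Fin n) F, u ∈ torus n F → (∀ i, ‖u.val i i‖ = 1) →
      ∀ i j, ‖u.val i j‖ ≤ 1 := by
    intro u hu h i j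
    by_cases hij : i = j
    · subst hij
      exact (h i).le
    · rw [mem_torus_iff.1 hu i j hij, norm_zero]
      exact zero_le_one
  refine Subgroup.mem_inf.2 ⟨mem_maximalCompact_of_norm_le_one (key t ht h)
    (key t⁻¹ (inv_mem ht) fun i => ?_), torus_le_levi c ht⟩
  rw [torus_inv_apply ht, norm_inv, h, inv_one]

variable (c) in
/-- The determinant of the diagonal block with index `b`. -/
def blockDet (b : Fin c.length) (A : Matrix (Fin n) (Fin n) F) : F :=
  (A.toSquareBlock c.index b).det

/-- Only the left factor has to be block diagonal: its rows in block `b` see only the rows of `A` in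
block `b`. -/
theorem blockDet_mul (b : Fin c.length) {g : GL (Fin n) F} (hg : g ∈ levi c F)
    (A : Matrix (Fin n) (Fin n) F) :
    blockDet c b (g.val * A) = blockDet c b g.val * blockDet c b A := by
  rw [blockDet, blockDet, blockDet, ← Matrix.det_mul]
  congr 1
  ext i j
  rw [Matrix.mul_apply]
  change (g.val * A) i j = ∑ k : {a // c.index a = b}, g.val i k * A k j
  rw [Matrix.mul_apply, ← Finset.sum_subtype (Finset.univ.filter fun k => c.index k = b) (by simp)
    fun k => g.val i k * A k j]
  refine (Finset.sum_subset (Finset.filter_subset _ _) fun k _ hk => ?_).symm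
  rw [(mem_levi_iff c F).1 hg i k fun h => hk (by simp [← h, i.2]), zero_mul]

theorem blockDet_one (b : Fin c.length) :
    blockDet c b (1 : Matrix (Fin n) (Fin n) F) = 1 := by
  have h : (1 : Matrix (Fin n) (Fin n) F).toSquareBlock c.index b = 1 := by
    ext i j
    simp [Matrix.toSquareBlock_def, Matrix.one_apply, Subtype.ext_iff]
  rw [blockDet, h, Matrix.det_one]

theorem norm_blockDet_of_compactLevi [IsUltrametricDist F] (b : Fin c.length) {k : GL (Fin n) F}
    (hk : k ∈ compactLevi c F) : ‖blockDet c b k.val‖ = 1 := by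
  have key : ∀ l ∈ compactLevi c F, ‖blockDet c b l.val‖ ≤ 1 := fun l hl =>
    norm_det_le_one fun i j =>
      norm_apply_le_one_of_mem_maximalCompact (compactLevi_le_maximalCompact hl) _ _
  have h := blockDet_mul b (compactLevi_le_levi hk) k⁻¹.val
  rw [Units.mul_inv, blockDet_one] at h
  have h' := congrArg norm h
  rw [norm_one, norm_mul] at h'
  have h1 := key k hk
  have h2 := key k⁻¹ (inv_mem hk)
  nlinarith [norm_nonneg (blockDet c b k.val), norm_nonneg (blockDet c b k⁻¹.val)]

theorem norm_blockDet_mul_mul [IsUltrametricDist F] (b : Fin c.length) {k₁ k₂ g : GL (Fin n) F}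
    (hk₁ : k₁ ∈ compactLevi c F) (hk₂ : k₂ ∈ compactLevi c F) (hg : g ∈ levi c F) :
    ‖blockDet c b (k₁ * g * k₂).val‖ = ‖blockDet c b g.val‖ := by
  rw [mul_assoc, Units.val_mul, blockDet_mul b (compactLevi_le_levi hk₁), Units.val_mul,
    blockDet_mul b hg, norm_mul, norm_mul, norm_blockDet_of_compactLevi b hk₁,
    norm_blockDet_of_compactLevi b hk₂, one_mul, mul_one]

theorem blockDet_torus (b : Fin c.length) {t : GL (Fin n) F} (ht : t ∈ torus n F) :
    blockDet c b t.val = ∏ i : {i // c.index i = b}, t.val i i := by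
  rw [blockDet, Matrix.det_of_isUpperTriangular]
  · rfl
  · intro i j hij
    exact mem_torus_iff.1 ht _ _ fun h => hij.ne' (Subtype.ext h)

theorem blockDet_blockUnipotent (b : Fin c.length) (y : BlockIndex c → F) :
    blockDet c b (blockUnipotent c y).val = 1 := by
  rw [blockDet, Matrix.det_of_isUpperTriangular]
  · exact Finset.prod_eq_one fun i _ => unipotent_apply_self _ _
  · intro i j hij
    exact unipotent_ones_apply _ hij

variable (c) in
/-- The indices up to `j` in the block of `j`. -/
def blockInitial (j : Fin n) : Finset (Fin n) :=
  Finset.univ.filter fun i => c.index i = c.index j ∧ i ≤ j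

theorem mem_blockInitial {i j : Fin n} :
    i ∈ blockInitial c j ↔ c.index i = c.index j ∧ i ≤ j := by
  simp [blockInitial]

/-- Both sides come from the minor of `t * blockUnipotent c y` on the initial segment of a block.
Triangularity evaluates it as the product of the `t i i`; the expression `k₁ * t' * k₂` bounds it by
the product of the largest entries of `t'` in that block, which are the first ones. -/
theorem prod_blockInitial_le [IsUltrametricDist F] {t t' : GL (Fin n) F} (ht : t ∈ torus n F)
    (ht' : t' ∈ torus n F)
    (hsort : ∀ i j, i ≤ j → c.index i = c.index j → ‖t' j j‖ ≤ ‖t' i i‖)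
    {k₁ k₂ : GL (Fin n) F} (hk₁ : k₁ ∈ compactLevi c F) (hk₂ : k₂ ∈ compactLevi c F)
    {y : BlockIndex c → F} (h : t * blockUnipotent c y = k₁ * t' * k₂) (j : Fin n) :
    ∏ i ∈ blockInitial c j, ‖t i i‖ ≤ ∏ i ∈ blockInitial c j, ‖t' i i‖ := by
  set R := blockInitial c j
  have h1 : ((t * blockUnipotent c y).val.submatrix ((↑) : R → Fin n) (↑)).det =
      ∏ i : R, t i i := by
    rw [Matrix.det_of_isUpperTriangular]
    · refine Finset.prod_congr rfl fun i _ => ?_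
      rw [Matrix.submatrix_apply, torus_mul_apply ht, blockUnipotent, unipotent_apply_self, mul_one]
    · intro a b hab
      rw [Matrix.submatrix_apply, torus_mul_apply ht, blockUnipotent, unipotent_ones_apply _ (show b.1 < a.1 from hab),
        mul_zero]
  have h2 : (t * blockUnipotent c y).val.submatrix ((↑) : R → Fin n) (↑) =
      k₁.val.submatrix ((↑) : R → Fin n) id * Matrix.diagonal (fun i => t'.val i i) *
        k₂.val.submatrix id ((↑) : R → Fin n) := by
    rw [h, Units.val_mul, Units.val_mul]
    nth_rewrite 1 [val_eq_diagonal ht']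
    rfl
  rw [← Finset.prod_coe_sort, ← norm_prod, ← h1, h2]
  refine norm_det_mul_diagonal_mul_le R _ _ _
    (fun _ _ => norm_apply_le_one_of_mem_maximalCompact (compactLevi_le_maximalCompact hk₁) _ _)
    (fun _ _ => norm_apply_le_one_of_mem_maximalCompact (compactLevi_le_maximalCompact hk₂) _ _) ?_
  intro a l hal hl i hi
  have ha := mem_blockInitial.1 a.2
  have hi' := mem_blockInitial.1 hi
  have hidx : c.index a = c.index l := by
    by_contra hne
    exact hal ((mem_levi_iff c F).1 (compactLevi_le_levi hk₁) a l hne)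
  have hlj : c.index l = c.index j := hidx.symm.trans ha.1
  have hjl : j < l := by
    by_contra hjl
    exact hl (mem_blockInitial.2 ⟨hlj, not_lt.1 hjl⟩)
  exact hsort i l (hi'.2.trans hjl.le) (hi'.1.trans hlj.symm)

theorem norm_eq_of_prod_blockInitial_eq {t t' : GL (Fin n) F} (ht : t ∈ torus n F)
    (h : ∀ j, ∏ i ∈ blockInitial c j, ‖t i i‖ = ∏ i ∈ blockInitial c j, ‖t' i i‖) (j : Fin n) :
    ‖t j j‖ = ‖t' j j‖ := by
  induction j using WellFoundedLT.induction with
  | ind j ih =>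
    have hj : j ∈ blockInitial c j := mem_blockInitial.2 ⟨rfl, le_rfl⟩
    have h1 := h j
    rw [← Finset.mul_prod_erase _ _ hj, ← Finset.mul_prod_erase _ (fun i => ‖t' i i‖) hj,
      ← Finset.prod_congr rfl fun i hi => ih i (lt_of_le_of_ne
        (mem_blockInitial.1 (Finset.mem_of_mem_erase hi)).2 (Finset.ne_of_mem_erase hi))] at h1
    exact mul_right_cancel₀ (Finset.prod_ne_zero_iff.2 fun i _ =>
      norm_ne_zero_iff.2 (torus_apply_ne_zero ht i)) h1

end BlockDet

/-! ### Injectivity of the Satake transform, relative to block determinants -/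

section Support

open MeasureTheory

variable {n : ℕ} {c : Composition n} {F : Type*} [NontriviallyNormedField F]

/-- `t` and `t * u` have the same diagonal, and diagonal entries are bounded on the compact support
of `f`. -/
theorem exists_bound_of_nilIntegral_ne_zero [ProperSpace F] [MeasurableSpace F] [BorelSpace F]
    {f : GL (Fin n) F → ℂ} (hf : HasCompactSupport f)
    (c : Composition n) :
    ∃ C : ℝ, ∀ t ∈ torus n F, nilIntegral c f t ≠ 0 → ∀ i, ‖t i i‖ ≤ C := by
  have hcont : Continuous fun (g : GL (Fin n) F) (i : Fin n) => g.val i i :=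
    continuous_pi fun i => Units.continuous_val.matrix_elem i i
  obtain ⟨C, hC⟩ := (hf.isCompact.image hcont).isBounded.exists_norm_le
  refine ⟨C, fun t ht h i => ?_⟩
  obtain ⟨x, hx⟩ : ∃ x : NilIndex c → F, f (t * unipotent c x) ≠ 0 := by
    by_contra h0
    push Not at h0
    exact h (by simp [nilIntegral, h0])
  have h1 := hC _ ⟨_, subset_tsupport _ hx, rfl⟩
  refine ((norm_le_pi_norm _ i).trans h1).trans' ?_
  change _ ≤ ‖(t * unipotent c x).val i i‖
  rw [torus_mul_apply ht, unipotent_apply_self, mul_one]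

variable [IsUltrametricDist F]

theorem blockUnipotent_mem_compactLevi {y : BlockIndex c → F} (hy : ∀ i, ‖y i‖ ≤ 1) :
    blockUnipotent c y ∈ compactLevi c F := by
  have hle : ∀ i j : Fin n, ‖(1 : Matrix (Fin n) (Fin n) F) i j‖ ≤ 1 := by
    intro i j
    rw [Matrix.one_apply]
    split_ifs <;> simp
  have hx : ∀ ij, ‖joinEntries (0 : NilIndex c → F) y ij‖ ≤ 1 := by
    intro ij
    rw [joinEntries]
    split_ifs
    · simp
    · exact hy _
  have h1 : ∀ i j, ‖(blockUnipotent c y).val i j‖ ≤ 1 := fun i j =>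
    (IsUltrametricDist.norm_add_le_max _ _).trans (max_le (hle i j) (norm_nilMatrix_le_one hx i j))
  have h2 : (blockUnipotent c y)⁻¹.val = (blockUnipotent c y).val.adjugate := by
    rw [Matrix.coe_units_inv, Matrix.inv_def, blockUnipotent, val_unipotent,
      det_one_add_nilMatrix, Ring.inverse_one, one_smul]
  refine Subgroup.mem_inf.2 ⟨mem_maximalCompact_of_norm_le_one h1 fun i j => ?_,
    blockUnipotent_mem_levi y⟩
  rw [h2, Matrix.adjugate_apply]
  refine norm_det_le_one fun a b => ?_
  rw [Matrix.updateRow_apply]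
  split_ifs
  · rw [Pi.single_apply]
    split_ifs <;> simp
  · exact h1 a b

variable [ProperSpace F] [MeasurableSpace F] [BorelSpace F]

/-- After division by `a` the integrand takes values in `{0, 1}` and is `1` on an open ball, which
has positive measure. -/
theorem integral_ne_zero_of_eq_or_eq_zero {ι : Type*} [Fintype ι] {φ : (ι → F) → ℂ} {a : ℂ}
    (ha : a ≠ 0) (hintegrable : Integrable φ (Measure.pi fun _ => haarF F))
    (hφ : ∀ y, φ y ≠ 0 → φ y = a) (hball : ∀ y, (∀ i, ‖y i‖ ≤ 1) → φ y = a) :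
    ∫ y, φ y ∂(Measure.pi fun _ => haarF F) ≠ 0 := by
  intro h0
  set ψ : (ι → F) → ℝ := fun y => RCLike.re (φ y / a) with hψ
  have hintegrable' := hintegrable.div_const a
  have hψ0 : ∫ y, ψ y ∂(Measure.pi fun _ => haarF F) = 0 := by
    rw [hψ, integral_re hintegrable', integral_div, h0]
    simp
  have hnn : 0 ≤ ψ := by
    intro y
    by_cases h : φ y = 0
    · simp [hψ, h]
    · simp [hψ, hφ y h, ha]
  have hae := (integral_eq_zero_iff_of_nonneg hnn hintegrable'.re).1 hψ0
  have hpos : 0 < (Measure.pi fun _ : ι => haarF F) (Metric.ball 0 1) :=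
    Metric.isOpen_ball.measure_pos _ ⟨0, Metric.mem_ball_self one_pos⟩
  refine hpos.ne' (measure_mono_null (fun y hy => ?_) hae)
  have hy' : ∀ i, ‖y i‖ ≤ 1 := fun i =>
    (norm_le_pi_norm y i).trans (mem_ball_zero_iff.1 hy).le
  change ¬ ψ y = 0
  simp [hψ, hball y hy', ha]

/-- If `∫_N f(m u) du ≠ 0` for some `m ∈ M(F)`, then the Satake transform of `f` does not vanish
at some `t ∈ T(F)` whose block determinants have the same norms as those of `m`. -/
theorem exists_torus_nilIntegral_ne_zero {ϖ : integers F} (hϖ : Irreducible ϖ)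
    {f : GL (Fin n) F → ℂ} (hf : IsUnramified f) {m : GL (Fin n) F} (hm : m ∈ levi c F)
    (hfm : nilIntegral c f m ≠ 0) :
    ∃ t ∈ torus n F, nilIntegral (Composition.ones n) f t ≠ 0 ∧
      ∀ b, ‖blockDet c b t.val‖ = ‖blockDet c b m.val‖ := by
  let Good : GL (Fin n) F → Prop := fun t => t ∈ torus n F ∧
    (∀ i j, i ≤ j → c.index i = c.index j → ‖t j j‖ ≤ ‖t i i‖) ∧ nilIntegral c f t ≠ 0 ∧
    ∀ b, ‖blockDet c b t.val‖ = ‖blockDet c b m.val‖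
  have hcartan : ∀ g ∈ levi c F, nilIntegral c f g ≠ 0 →
      (∀ b, ‖blockDet c b g.val‖ = ‖blockDet c b m.val‖) →
      ∃ t, Good t ∧ nilIntegral c f t = nilIntegral c f g ∧
        ∃ k₁ ∈ compactLevi c F, ∃ k₂ ∈ compactLevi c F, g = k₁ * t * k₂ := by
    intro g hg hfg hdet
    obtain ⟨t, ht, ⟨k₁, hk₁, k₂, hk₂, rfl⟩, hsort⟩ := exists_cartan hg
    have hfg' : nilIntegral c f t = nilIntegral c f (k₁ * t * k₂) := by
      rw [nilIntegral_mul_right hf hk₂, nilIntegral_mul_left hf (compactLevi_le_maximalCompact hk₁)]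
    refine ⟨t, ⟨ht, hsort, by rwa [hfg'], fun b => ?_⟩, hfg', k₁, hk₁, k₂, hk₂, rfl⟩
    rw [← hdet b, norm_blockDet_mul_mul b hk₁ hk₂ (torus_le_levi c ht)]
  -- A single number monotone for the dominance order of `prod_blockInitial_le`: if every inner
  -- product grows weakly and `D` does not increase, all inner products are equal.
  let D : GL (Fin n) F → ℝ := fun t => ∏ j, ∏ i ∈ blockInitial c j, ‖t i i‖
  have hpos : ∀ t ∈ torus n F, ∀ j, 0 < ∏ i ∈ blockInitial c j, ‖t i i‖ := fun t ht j =>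
    Finset.prod_pos fun i _ => norm_pos_iff.2 (torus_apply_ne_zero ht i)
  have h0 := norm_uniformizer_pos hϖ
  have h1 := norm_uniformizer_lt_one hϖ
  have hDz : ∀ t ∈ torus n F, ∃ z : ℤ, D t = ‖(ϖ : F)‖ ^ z := by
    intro t ht
    obtain ⟨z, hz⟩ := exists_norm_eq_zpow hϖ (x := ∏ j, ∏ i ∈ blockInitial c j, t i i)
      (Finset.prod_ne_zero_iff.2 fun j _ => Finset.prod_ne_zero_iff.2 fun i _ =>
        torus_apply_ne_zero ht i)
    exact ⟨z, by rw [← hz, norm_prod]; simp only [norm_prod, D]⟩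
  obtain ⟨C, hC⟩ := exists_bound_of_nilIntegral_ne_zero hf.hasCompactSupport c
  obtain ⟨t, ht, hmax⟩ : ∃ t, Good t ∧ ∀ t', Good t' → D t' ≤ D t := by
    -- `D` takes values in the powers of `‖ϖ‖` and is bounded on `Good`. The exponents are thus
    -- bounded below by `-N`, and a least exponent gives a maximum of `D`.
    obtain ⟨N, hN⟩ := exists_pow_lt_of_lt_one
      (inv_pos.2 (show (0 : ℝ) < |∏ j, ∏ _i ∈ blockInitial c j, C| + 1 by positivity)) h1
    obtain ⟨t₀, ht₀, -⟩ := hcartan m hm hfm fun _ => rfl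
    obtain ⟨z₀, hz₀⟩ := hDz t₀ ht₀.1
    have hbdd : ∀ z : ℤ, (∃ t, Good t ∧ D t = ‖(ϖ : F)‖ ^ z) → -(N : ℤ) ≤ z := by
      rintro z ⟨t, ht, hz⟩
      by_contra hlt
      push Not at hlt
      have hDC : D t ≤ ∏ j, ∏ _i ∈ blockInitial c j, C :=
        Finset.prod_le_prod (fun j _ => (hpos t ht.1 j).le) fun j _ =>
          Finset.prod_le_prod (fun _ _ => norm_nonneg _) fun i _ => hC t ht.1 ht.2.2.1 i
      have hzN : ‖(ϖ : F)‖ ^ (-(N : ℤ)) ≤ ‖(ϖ : F)‖ ^ z :=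
        zpow_le_zpow_right_of_le_one₀ h0 h1.le hlt.le
      rw [zpow_neg, zpow_natCast, ← hz] at hzN
      have hinv := (lt_inv_comm₀ (pow_pos h0 N) (by positivity)).1 hN
      linarith [le_abs_self (∏ j, ∏ _i ∈ blockInitial c j, C)]
    obtain ⟨z, ⟨t, ht, hz⟩, hzmin⟩ := Int.exists_least_of_bdd ⟨_, hbdd⟩ ⟨z₀, t₀, ht₀, hz₀⟩
    refine ⟨t, ht, fun t' ht' => ?_⟩
    obtain ⟨z', hz'⟩ := hDz t' ht'.1
    rw [hz, hz']
    exact zpow_le_zpow_right_of_le_one₀ h0 h1.le (hzmin z' ⟨t', ht', hz'⟩)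
  obtain ⟨httorus, htsort, htne, htdet⟩ := ht
  refine ⟨t, httorus, ?_, htdet⟩
  obtain ⟨hintegrable, heq⟩ :=
    integral_unipotent_ones (c := c) hf.isLocallyConstant.continuous hf.hasCompactSupport t
  rw [heq]
  refine integral_ne_zero_of_eq_or_eq_zero htne hintegrable (fun y hy => ?_) fun y hy =>
    nilIntegral_mul_right hf (blockUnipotent_mem_compactLevi hy) t
  obtain ⟨t', ht', hft', k₁, hk₁, k₂, hk₂, hk⟩ := hcartan (t * blockUnipotent c y)
    (mul_mem (torus_le_levi c httorus) (blockUnipotent_mem_levi y)) hy fun b => by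
      rw [Units.val_mul, blockDet_mul b (torus_le_levi c httorus), blockDet_blockUnipotent,
        mul_one, htdet]
  have hle := prod_blockInitial_le httorus ht'.1 ht'.2.1 hk₁ hk₂ hk
  have hprod : ∀ j, ∏ i ∈ blockInitial c j, ‖t i i‖ = ∏ i ∈ blockInitial c j, ‖t' i i‖ := by
    by_contra hne
    push Not at hne
    obtain ⟨j, hj⟩ := hne
    exact (hmax t' ht').not_gt (Finset.prod_lt_prod (fun j _ => hpos t httorus j)
      (fun j _ => hle j) ⟨j, Finset.mem_univ j, lt_of_le_of_ne (hle j) hj⟩)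
  have hnorm := norm_eq_of_prod_blockInitial_eq (t' := t') httorus hprod
  -- Equal norms on the diagonal put `t` and `t'` in the same coset of `T(𝒪_F)`, so the integral has
  -- the same value at both.
  have hk' : t⁻¹ * t' ∈ compactLevi c F := by
    refine mem_compactLevi_of_torus (mul_mem (inv_mem httorus) ht'.1) fun i => ?_
    rw [torus_mul_apply (inv_mem httorus), torus_inv_apply httorus, norm_mul, norm_inv, ← hnorm]
    exact inv_mul_cancel₀ (norm_ne_zero_iff.2 (torus_apply_ne_zero httorus i))
  rw [← hft', ← nilIntegral_mul_right hf hk' t, mul_inv_cancel_left]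

end Support

/-! ### The support of the Kottwitz polynomial -/

section Polynomial

variable {n : ℕ}

theorem prod_X_pow (I : Finset (Fin n)) (α : ℕ) :
    (∏ i ∈ I, X i) ^ α =
      (AddMonoidAlgebra.single (fun i => if i ∈ I then (α : ℤ) else 0) 1 : LaurentRing n) := by
  have h : ∏ i ∈ I, X i = (AddMonoidAlgebra.single (∑ i ∈ I, Pi.single i 1) 1 : LaurentRing n) := by
    induction I using Finset.induction_on with
    | empty => simp [AddMonoidAlgebra.one_def]
    | insert i I hi ih =>
      rw [Finset.prod_insert hi, Finset.sum_insert hi, ih, X, AddMonoidAlgebra.single_mul_single,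
        one_mul]
  rw [h, AddMonoidAlgebra.single_pow, one_pow]
  congr 1
  funext i
  simp [Finset.sum_apply, Pi.single_apply]

theorem exists_of_coeff_kottwitzPolynomial_ne_zero {q α s : ℕ} {l : Fin n → ℤ}
    (h : (kottwitzPolynomial q n α s).coeff l ≠ 0) :
    ∃ I : Finset (Fin n), I.card = s ∧ l = fun i => if i ∈ I then (α : ℤ) else 0 := by
  rw [kottwitzPolynomial, AddMonoidAlgebra.coeff_smul, Finsupp.smul_apply,
    AddMonoidAlgebra.coeff_sum, Finsupp.finsetSum_apply] at h
  obtain ⟨I, hI, hne⟩ := Finset.exists_ne_zero_of_sum_ne_zero (right_ne_zero_of_smul h)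
  refine ⟨I, (Finset.mem_powersetCard.1 hI).2, ?_⟩
  rw [prod_X_pow, AddMonoidAlgebra.coeff_single] at hne
  by_contra hl
  exact hne (Finsupp.single_eq_of_ne hl)

theorem exists_of_toTorusFunction_ne_zero {F : Type*} [NontriviallyNormedField F]
    [IsUltrametricDist F] {ϖ : integers F} {q α s : ℕ} {t : torus n F}
    (h : toTorusFunction ϖ (kottwitzPolynomial q n α s) t ≠ 0) :
    ∃ I : Finset (Fin n), I.card = s ∧
      ∀ i, ‖(t : GL (Fin n) F) i i‖ = ‖(ϖ : F)‖ ^ (if i ∈ I then α else 0) := by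
  rw [toTorusFunction, Finsupp.sum] at h
  obtain ⟨l, -, hl⟩ := Finset.exists_ne_zero_of_sum_ne_zero h
  split_ifs at hl with hnorm
  · obtain ⟨I, hI, rfl⟩ := exists_of_coeff_kottwitzPolynomial_ne_zero hl
    refine ⟨I, hI, fun i => ?_⟩
    rw [hnorm i]
    by_cases hi : i ∈ I <;> simp [hi]
  · exact absurd rfl hl

theorem exists_of_satake_ne_zero {F : Type*} [NontriviallyNormedField F] [IsUltrametricDist F]
    [ProperSpace F] [MeasurableSpace F] [BorelSpace F] {ϖ : integers F} {α s : ℕ}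
    {f : GL (Fin n) F → ℂ} (hf : IsKottwitzFunction ϖ α s f) {t : GL (Fin n) F}
    (ht : t ∈ torus n F) (h : nilIntegral (Composition.ones n) f t ≠ 0) :
    ∃ I : Finset (Fin n), I.card = s ∧ ∀ i, ‖t i i‖ = ‖(ϖ : F)‖ ^ (if i ∈ I then α else 0) := by
  have h1 : satake f ⟨t, ht⟩ ≠ 0 := by
    -- The adjoint action unfolds to `X ↦ t X t⁻¹`, the automorphism `nilEquiv`, so the modular
    -- factor is nonzero.
    have hdet : LinearMap.det (adjointAction (Composition.ones n) t) ≠ 0 :=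
      (nilEquiv ht (inv_mem ht)).isUnit_det'.ne_zero
    refine mul_ne_zero ?_ h
    rw [Complex.ofReal_ne_zero]
    exact (Real.rpow_pos_of_pos (norm_pos_iff.2 hdet) _).ne'
  rw [hf.satake_eq] at h1
  exact exists_of_toTorusFunction_ne_zero h1

end Polynomial

/-! ### Compact elements -/

section Compact

variable {n : ℕ} {c : Composition n} {F : Type*} [NontriviallyNormedField F]

/-- The characteristic polynomial of a block divides that of `m`, so the block determinant is a
product of eigenvalues of `m`, all of the same norm. The spectral norm is multiplicative because `F`
is complete, and it extends the norm of `F`. -/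
theorem exists_norm_blockDet_eq [IsUltrametricDist F] [ProperSpace F] (hn : 0 < n) {m : GL (Fin n) F} (hm : m ∈ levi c F)
    (hcpt : m ∈ compactElements n F) :
    ∃ x : ℝ, ∀ b, ‖blockDet c b m.val‖ = ∏ _i : {i // c.index i = b}, x := by
  have hcomplete : CompleteSpace F := inferInstance
  let A := AlgebraicClosure F
  have hchar : m.val.charpoly ≠ 0 := (Matrix.charpoly_monic _).ne_zero
  have hcard : (m.val.charpoly.aroots A).card = n := by
    rw [Polynomial.aroots_def, IsAlgClosed.card_roots_eq_natDegree, Polynomial.natDegree_map,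
      Matrix.charpoly_natDegree_eq_dim, Fintype.card_fin]
  obtain ⟨r, hr⟩ := Multiset.card_pos_iff_exists_mem.1 (hcard ▸ hn)
  refine ⟨spectralNorm F A r, fun b => ?_⟩
  set B := m.val.toSquareBlock c.index b with hB
  have hdvd : B.charpoly ∣ m.val.charpoly := by
    have h := Matrix.BlockTriangular.charpoly m.val hm.1
    by_cases hb : b ∈ Finset.image c.index Finset.univ
    · rw [h]
      exact Finset.dvd_prod_of_mem _ hb
    · have : IsEmpty {i // c.index i = b} := ⟨fun i => hb (by simp [← i.2])⟩
      simp [Matrix.charpoly_isEmpty]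
  have hroots : ∀ y ∈ B.charpoly.aroots A, spectralMulAlgNorm F A y = spectralNorm F A r := by
    intro y hy
    exact hcpt y (Multiset.mem_of_le (Polynomial.roots.le_of_dvd
      (Polynomial.map_ne_zero hchar) (Polynomial.map_dvd _ hdvd)) hy) r hr
  have hdet : algebraMap F A B.det = (B.charpoly.aroots A).prod := by
    rw [RingHom.map_det, RingHom.mapMatrix_apply, Matrix.det_eq_prod_roots_charpoly,
      Matrix.charpoly_map, Polynomial.aroots_def]
  have hcardB : (B.charpoly.aroots A).card = Fintype.card {i // c.index i = b} := by
    rw [Polynomial.aroots_def, IsAlgClosed.card_roots_eq_natDegree, Polynomial.natDegree_map,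
      Matrix.charpoly_natDegree_eq_dim]
  rw [blockDet, ← hB, ← spectralNorm_extends (L := A) B.det, hdet, ← spectralMulAlgNorm_def,
    map_multiset_prod, Multiset.map_congr rfl hroots, Multiset.map_const', Multiset.prod_replicate,
    hcardB, Finset.prod_const, Finset.card_univ]

/-- Computing `x ^ (n * nb)` from the whole matrix and from the block gives `s * nb = sb * n`, where
`sb` counts the elements of `I` in the block; then `n`, being prime to `s`, divides `nb`. -/
theorem card_block_eq_of_compact {ϖ : F} (h0 : 0 < ‖ϖ‖) (h1 : ‖ϖ‖ < 1) {α s : ℕ} (hα : 0 < α)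
    (hcop : Nat.Coprime s n) {I : Finset (Fin n)} (hI : I.card = s) {t : Fin n → ℝ} {x : ℝ}
    (ht : ∀ i, t i = ‖ϖ‖ ^ (if i ∈ I then α else 0))
    (hx : ∀ b, ∏ i : {i // c.index i = b}, t i = ∏ _i : {i // c.index i = b}, x)
    (b : Fin c.length) : n ∣ Fintype.card {i // c.index i = b} := by
  set nb := Fintype.card {i // c.index i = b}
  set sb := Fintype.card {i : {i // c.index i = b} // i.1 ∈ I}
  have hall : x ^ n = ‖ϖ‖ ^ (s * α) := by
    have h := Finset.prod_congr (rfl : Finset.univ = Finset.univ) fun b _ => hx b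
    rw [Fintype.prod_fiberwise c.index t, Fintype.prod_fiberwise c.index fun _ => x,
      Finset.prod_const, Finset.card_univ, Fintype.card_fin] at h
    rw [← h, Finset.prod_congr rfl fun i _ => ht i, Finset.prod_pow_eq_pow_sum]
    congr 1
    simp [hI]
  have hb : x ^ nb = ‖ϖ‖ ^ (sb * α) := by
    have h := hx b
    rw [Finset.prod_const, Finset.card_univ] at h
    rw [← h, Finset.prod_congr rfl fun i _ => ht i.1, Finset.prod_pow_eq_pow_sum]
    congr 1
    rw [← Finset.sum_filter, Finset.sum_const, smul_eq_mul]
    exact congrArg (· * α) (Fintype.card_subtype _).symm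
  have hpow : ‖ϖ‖ ^ (s * α * nb) = ‖ϖ‖ ^ (sb * α * n) := by
    rw [pow_mul, ← hall, pow_mul, ← hb, ← pow_mul, ← pow_mul, mul_comm]
  have heq := (pow_right_strictAnti₀ h0 h1).injective hpow
  have heq' : s * nb = sb * n := by
    refine Nat.eq_of_mul_eq_mul_left hα ?_
    linarith
  exact hcop.symm.dvd_of_dvd_mul_left (heq' ▸ Dvd.intro_left sb rfl)

/-- A matrix outside `P` has a nonzero entry `(i, j)` below the diagonal blocks, so the block of `i`
misses `j`. -/
theorem exists_card_block_lt (hP : parabolic c F ≠ ⊤) :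
    ∃ b, 0 < Fintype.card {i // c.index i = b} ∧ Fintype.card {i // c.index i = b} < n := by
  obtain ⟨g, -, hg⟩ := SetLike.exists_of_lt hP.lt_top
  obtain ⟨i, j, hij, -⟩ : ∃ i j, c.index j < c.index i ∧ g.val i j ≠ 0 := by
    by_contra h
    push Not at h
    exact hg fun i j hij => h i j hij
  refine ⟨c.index i, Fintype.card_pos_iff.2 ⟨⟨i, rfl⟩⟩, ?_⟩
  have := Fintype.card_subtype_lt (p := fun k => c.index k = c.index i) (x := j) hij.ne
  rwa [Fintype.card_fin] at this

end Compact

end KottwitzFunction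

end

theorem proposition5p1 {F : Type*} [NontriviallyNormedField F] [IsUltrametricDist F]
    [ProperSpace F] [CharZero F] [MeasurableSpace F] [BorelSpace F]
    (ϖ : KottwitzFunction.integers F) (hϖ : Irreducible ϖ)
    (hnorm : ‖(ϖ : F)‖ = (KottwitzFunction.residueCard F : ℝ)⁻¹)
    (n α s : ℕ) (hn : 0 < n) (hα : 0 < α) (hs : 0 < s) (hsn : s ≤ n) (hcop : Nat.Coprime s n)
    (f : GL (Fin n) F → ℂ) (hf : KottwitzFunction.IsKottwitzFunction ϖ α s f)
    (c : Composition n) (hP : KottwitzFunction.parabolic c F ≠ ⊤) :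
    (fun m : KottwitzFunction.levi c F =>
      KottwitzFunction.compactIndicator n F (m : GL (Fin n) F) *
        KottwitzFunction.constantTerm c f m) = 0 := by
  open KottwitzFunction in
  funext ⟨m, hm⟩
  by_contra hne
  obtain ⟨hcpt, hterm⟩ := mul_ne_zero_iff.1 hne
  have hcpt' : m ∈ compactElements n F := Set.mem_of_indicator_ne_zero hcpt
  have hintegrable : nilIntegral c f m ≠ 0 := right_ne_zero_of_mul hterm
  obtain ⟨t, ht, hft, htdet⟩ := exists_torus_nilIntegral_ne_zero hϖ hf.isUnramified hm hintegrable
  obtain ⟨I, hI, htI⟩ := exists_of_satake_ne_zero hf ht hft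
  obtain ⟨x, hx⟩ := exists_norm_blockDet_eq hn hm hcpt'
  obtain ⟨b, hb0, hbn⟩ := exists_card_block_lt hP
  -- A block that is nonempty and smaller than `n` cannot have size divisible by `n`.
  refine (Nat.le_of_dvd hb0 ?_).not_gt hbn
  refine card_block_eq_of_compact (norm_uniformizer_pos hϖ) (norm_uniformizer_lt_one hϖ) hα hcop hI
    (t := fun i => ‖t i i‖) (x := x) htI (fun b => ?_) b
  rw [← hx, ← htdet, blockDet_torus b ht, norm_prod]
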